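/- Let $p,q,r\ge 0$ be integers and let $\mu>0$ be real. Let $Z$ be the open set of complex $(p+q)\times p$ matrices $z=(z^A_i)$ of rank $p$, with right $GL(p,\mathbb{C})$-action $z\mapsto zg$, and put $x=z^\dagger z$. Let $\lambda$ be a formal parameter. On formal power series in $\lambda$ with coefficients in $C^\infty(Z)$ (complex valued) let $\tilde *$ be the Wick star product $$F\,\tilde *\,G=\sum_{n\ge 0}\frac{\lambda^n}{n!}\sum_{A_1,\dots,A_n}\sum_{i_1,\dots,i_n}\frac{\partial^nF}{\partial z^{A_1}_{i_1}\cdots\partial z^{A_n}_{i_n}}\cdot\frac{\partial^nG}{\partial \bar z^{A_1}_{i_1}\cdots\partial\bar z^{A_n}_{i_n}} .$$ Let $C^\infty_{hom}[[\lambda]]$ be the series whose coefficients are $GL(p,\mathbb{C})$-invariant, and let $\mathcal{J}$ be the set of all series of the form $\sum_{i,j}G^i_{\ j}\,\tilde *\,(x-\mu 1)^j_{\ i}$, where $G$ runs over the formal power series of smooth functions $Z\to \mathfrak{gl}(p,\mathbb{C})$ that are $U(p)$-equivariant, $G(zU)=U^\dagger G(z)U$. If $F$ has a unique decomposition $F=f+g$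 with $f\in C^\infty_{hom}[[\lambda]]$ and $g\in\mathcal{J}$, write $P(F)=f$; for tensors, $P$ is applied to each component. Put $$S=zx^{-2}z^\dagger,\qquad \zeta=z(z^\dagger z)^{-1/2}\mu^{1/2},\qquad T=\mu^{-1}\zeta\zeta^\dagger,\qquad c=\lambda^{-1}\mu+p\in\mathbb{C}((\lambda)).$$ For $\sigma\in S_r$ let $\rho(\sigma)$ be the endomorphism $e_{A_1}\otimes\dots\otimes e_{A_r}\mapsto e_{A_{\sigma(1)}}\otimes\dots\otimes e_{A_{\sigma(r)}}$ of $(\mathbb{C}^{p+q})^{\otimes r}$, extended linearly to the group algebra of $S_r$ over $\mathbb{C}((\lambda))$. Let $Con(S_r)$ be the set of conjugacy classes of $S_r$; for $\alpha\in Con(S_r)$ let $k_\alpha=\sum_{\sigma\in\alpha}\sigma$, and let $|\alpha|$ be the number of cycles (fixed points included) of any $\sigma\in\alpha$. Then every component of $S^{\otimes r}$ has a unique decomposition as above, so that $P(S^{\otimes r})$ is defined, and $$\lambda^r\,\rho\Big(\sum_{\alpha\in Con(S_r)}c^{|\alpha|}k_\alpha\Big)\,P(S^{\otimes r})=T^{\otimes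 r}.$$ -/

import Mathlib

open scoped ContDiff MatrixOrder

attribute [local instance] Matrix.normedAddCommGroup Matrix.normedSpace

noncomputable section

namespace GrassmannStar

/-! ### The phase space and its function spaces -/

/-- The space of complex `(p+q) × p` matrices of rank `p`. -/
abbrev PhaseSpace (p q : ℕ) : Type :=
  {z : Matrix (Fin (p + q)) (Fin p) ℂ // z.rank = p}

variable {p q : ℕ}

/-- The right action `z ↦ z g` of `GL(p, ℂ)`. -/
def PhaseSpace.act (z : PhaseSpace p q) (g : Matrix.GeneralLinearGroup (Fin p) ℂ) :
    PhaseSpace p q :=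
  ⟨z.1 * g.1, by
    rw [Matrix.rank_mul_eq_left_of_isUnit_det _ _ ((Matrix.isUnit_iff_isUnit_det _).1 g.isUnit)]
    exact z.2⟩

/-- A unitary matrix as an element of `GL(p, ℂ)`. -/
def unitaryToGL (U : Matrix.unitaryGroup (Fin p) ℂ) : Matrix.GeneralLinearGroup (Fin p) ℂ :=
  Unitary.toUnits U

open Classical in
/-- Extension by zero of a function on the (open) set of matrices of rank `p` to all matrices;
it only serves to speak about derivatives at points of that open set. -/
def extend (f : PhaseSpace p q → ℂ) (w : Matrix (Fin (p + q)) (Fin p) ℂ) : ℂ :=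
  if h : w.rank = p then f ⟨w, h⟩ else 0

/-- Smoothness (in the real sense) of a complex valued function on the open set of matrices of
rank `p`. -/
def IsSmooth (f : PhaseSpace p q → ℂ) : Prop :=
  ContDiffOn ℝ ∞ (extend f) {w | w.rank = p}

/-- The holomorphic Wirtinger derivative `∂f/∂z^A_i`. -/
def dz (A : Fin (p + q)) (i : Fin p) (f : PhaseSpace p q → ℂ) : PhaseSpace p q → ℂ := fun z =>
  (1 / 2 : ℂ) * (fderiv ℝ (extend f) z.1 (Matrix.single A i 1)
    - Complex.I * fderiv ℝ (extend f) z.1 (Matrix.single A i Complex.I))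

/-- The antiholomorphic Wirtinger derivative, with respect to the complex conjugate of `z^A_i`,
that is, with respect to the entry `(z†)^i_A`. -/
def dzbar (A : Fin (p + q)) (i : Fin p) (f : PhaseSpace p q → ℂ) : PhaseSpace p q → ℂ := fun z =>
  (1 / 2 : ℂ) * (fderiv ℝ (extend f) z.1 (Matrix.single A i 1)
    + Complex.I * fderiv ℝ (extend f) z.1 (Matrix.single A i Complex.I))

/-- Formal power series in `λ` whose coefficients are functions on the phase space. -/
abbrev FormalFun (p q : ℕ) : Type := PowerSeries (PhaseSpace p q → ℂ)

/-- Evaluation of (the coefficients of) a formal function at a point. -/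
def evalAt (z : PhaseSpace p q) : FormalFun p q →+* PowerSeries ℂ :=
  PowerSeries.map (Pi.evalRingHom (fun _ : PhaseSpace p q => ℂ) z)

/-- `F ∈ C^∞_hom[[λ]]`: every coefficient is smooth and invariant under `GL(p, ℂ)`. -/
def IsHomogeneous (F : FormalFun p q) : Prop :=
  ∀ n, IsSmooth (PowerSeries.coeff n F) ∧
    ∀ (z : PhaseSpace p q) (g : Matrix.GeneralLinearGroup (Fin p) ℂ),
      PowerSeries.coeff n F (z.act g) = PowerSeries.coeff n F z

/-- `G` is a formal power series of smooth `U(p)`-equivariant functions with values in the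
complexification `gl(p, ℂ)` of `u(p)`: `G(zU) = U† G(z) U`. -/
def IsEquivariant (G : Matrix (Fin p) (Fin p) (FormalFun p q)) : Prop :=
  ∀ n, (∀ i j, IsSmooth (PowerSeries.coeff n (G i j))) ∧
    ∀ (z : PhaseSpace p q) (U : Matrix.unitaryGroup (Fin p) ℂ),
      (Matrix.of fun i j => PowerSeries.coeff n (G i j) (z.act (unitaryToGL U))) =
        star U.1 * (Matrix.of fun i j => PowerSeries.coeff n (G i j) z) * U.1

/-! ### The Wick star product, the star ideal and the projection -/

/-- `m ((∑ ∂/∂z^A_i ⊗ ∂/∂(z†)^i_A)^r (f ⊗ g))`, with `m` the pointwise multiplication. -/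
def wickBidiff : ℕ → (PhaseSpace p q → ℂ) → (PhaseSpace p q → ℂ) → (PhaseSpace p q → ℂ)
  | 0, f, g => f * g
  | r + 1, f, g => ∑ A, ∑ i, wickBidiff r (dz A i f) (dzbar A i g)

/-- The Wick star product `∑_r λ^r / r! · wickBidiff r`, extended `λ`-bilinearly to formal
power series. -/
def wickStar (F G : FormalFun p q) : FormalFun p q :=
  PowerSeries.mk fun n =>
    ∑ a ∈ Finset.HasAntidiagonal.antidiagonal n, ∑ b ∈ Finset.HasAntidiagonal.antidiagonal a.2,
      ((a.1.factorial : ℂ)⁻¹) •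
        wickBidiff a.1 (PowerSeries.coeff b.1 F) (PowerSeries.coeff b.2 G)

/-- `x = z† z`. -/
def xMat (z : Matrix (Fin (p + q)) (Fin p) ℂ) : Matrix (Fin p) (Fin p) ℂ :=
  z.conjTranspose * z

/-- The entries of `x - μ` as (constant in `λ`) formal functions. -/
def xSub (μ : ℝ) (j i : Fin p) : FormalFun p q :=
  PowerSeries.C fun z => (xMat z.1 - (μ : ℂ) • (1 : Matrix (Fin p) (Fin p) ℂ)) j i

/-- Membership in the star ideal generated by `x - μ`: `F = ∑ G^i_j * (x - μ)^j_i` for some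
equivariant `G`. -/
def InStarIdeal (μ : ℝ) (F : FormalFun p q) : Prop :=
  ∃ G : Matrix (Fin p) (Fin p) (FormalFun p q), IsEquivariant G ∧
    F = ∑ i, ∑ j, wickStar (G i j) (xSub μ j i)

/-- `f` is a homogeneous part of `F`: `f` is homogeneous and `F - f` lies in the star ideal. -/
def IsHomPart (μ : ℝ) (F f : FormalFun p q) : Prop :=
  IsHomogeneous f ∧ InStarIdeal μ (F - f)

open Classical in
/-- The projection onto homogeneous functions along the star ideal. -/
def proj (μ : ℝ) (F : FormalFun p q) : FormalFun p q :=
  if h : ∃ f, IsHomPart μ F f then h.choose else 0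

/-! ### Tensor powers and the action of the symmetric group

Endomorphisms of `(ℂ^s)^{⊗ r}` are written as matrices in the basis
`e_{A_1} ⊗ … ⊗ e_{A_r}`, indexed by `A : Fin r → Fin s`. -/

/-- The `r`-fold tensor (Kronecker) power of a matrix. -/
def tensorPow {R : Type*} [CommSemiring R] {s : ℕ} (M : Matrix (Fin s) (Fin s) R) (r : ℕ) :
    Matrix (Fin r → Fin s) (Fin r → Fin s) R :=
  Matrix.of fun B A => ∏ k, M (B k) (A k)

/-- `ρ(σ)`, which maps `e_{A_1} ⊗ … ⊗ e_{A_r}` to `e_{A_{σ(1)}} ⊗ … ⊗ e_{A_{σ(r)}}`. -/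
def rhoPerm (K : Type*) [CommSemiring K] (s : ℕ) {r : ℕ} (σ : Equiv.Perm (Fin r)) :
    Matrix (Fin r → Fin s) (Fin r → Fin s) K :=
  Matrix.of fun B A => if B = A ∘ σ then 1 else 0

/-- The linear extension of `ρ` to the group algebra `K[S_r]`. -/
def rho {K : Type*} [CommSemiring K] (s : ℕ) {r : ℕ} (a : MonoidAlgebra K (Equiv.Perm (Fin r))) :
    Matrix (Fin r → Fin s) (Fin r → Fin s) K :=
  ∑ σ, a.coeff σ • rhoPerm K s σ

/-- `|α| = α_1 + … + α_r`, the number of cycles (fixed points included) of the elements of the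
conjugacy class `α`. -/
def numCycles {r : ℕ} : ConjClasses (Equiv.Perm (Fin r)) → ℕ :=
  Quotient.lift (fun σ : Equiv.Perm (Fin r) => Multiset.card σ.partition.parts)
    fun _ _ h => by rw [Equiv.Perm.partition_eq_of_isConj.1 h]

open Classical in
/-- The class sum `k_α = ∑_{σ ∈ α} σ` in the group algebra. -/
def classSum (K : Type*) [CommSemiring K] {r : ℕ} (α : ConjClasses (Equiv.Perm (Fin r))) :
    MonoidAlgebra K (Equiv.Perm (Fin r)) :=
  ∑ σ with ConjClasses.mk σ = α, MonoidAlgebra.single σ 1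

/-! ### The matrices `S` and `T` -/

/-- `S = z x⁻² z†`. -/
def SMat (z : Matrix (Fin (p + q)) (Fin p) ℂ) : Matrix (Fin (p + q)) (Fin (p + q)) ℂ :=
  z * (xMat z)⁻¹ ^ 2 * z.conjTranspose

/-- `ζ = z (z† z)^{-1/2} μ^{1/2}`. -/
def zeta (μ : ℝ) (z : Matrix (Fin (p + q)) (Fin p) ℂ) : Matrix (Fin (p + q)) (Fin p) ℂ :=
  ((Real.sqrt μ : ℝ) : ℂ) • (z * (CFC.sqrt (xMat z))⁻¹)

/-- `T = μ⁻¹ ζ ζ†`. -/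
def TMat (μ : ℝ) (z : Matrix (Fin (p + q)) (Fin p) ℂ) : Matrix (Fin (p + q)) (Fin (p + q)) ℂ :=
  ((μ : ℂ)⁻¹) • (zeta μ z * (zeta μ z).conjTranspose)

/-- `S^{⊗ r}` as a tensor of formal functions on the phase space (constant in `λ`). -/
def STensor (p q r : ℕ) :
    Matrix (Fin r → Fin (p + q)) (Fin r → Fin (p + q)) (FormalFun p q) :=
  Matrix.of fun B A => PowerSeries.C fun z => tensorPow (SMat z.1) r B A

/-! ### Formal Laurent series in `λ` -/

/-- The formal parameter `λ` in `ℂ((λ))`. -/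
def lam : LaurentSeries ℂ := HahnSeries.single 1 1

/-- `c = λ⁻¹ μ + p` in `ℂ((λ))`. -/
def cParam (μ : ℝ) (p : ℕ) : LaurentSeries ℂ := lam⁻¹ * HahnSeries.C (μ : ℂ) + (p : LaurentSeries ℂ)

/-- The value at `z` of a tensor of formal functions, as a matrix over `ℂ((λ))`. -/
def laurentAt {ι : Type*} (M : Matrix ι ι (FormalFun p q)) (z : PhaseSpace p q) :
    Matrix ι ι (LaurentSeries ℂ) :=
  M.map fun F => HahnSeries.ofPowerSeries ℤ ℂ (evalAt z F)

end GrassmannStar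

end

open GrassmannStar

/-! ### Smooth functions and Wirtinger calculus on the matrices of full rank -/

noncomputable section

namespace GrassmannStar

open Matrix Topology
open scoped ComplexOrder

variable {p q : ℕ}

/-! ### The open set of matrices of full rank -/

/-! Since `x = z†z` is affine in `z̄`, the star product with `x − μ` stops after first order: `G *
(x−μ)_{ji} = G (x−μ)_{ji} + λ E_{ij} G`, where `E_{ij} = ∑_A z_{Ai} ∂/∂z_{Aj}` generates the right
action holomorphically (`wickStar_xSub`). These generators annihilate `z x⁻¹` and `z†`, hence `T = z
x⁻¹ z†`, and act on `x⁻¹z†` and `S` by explicit formulas.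

Existence. Feeding `G_{ij} = (x⁻¹z†)_{iA} (z x⁻¹)_{Bj} S⋯S` into the star ideal gives, modulo the
ideal, `T_{BA} S⋯S ≡ (μ + λp) S_{BA} S⋯S + λ ∑ (lower index A exchanged with that of one of the
other factors)` (`inStarIdeal_tEntry_mul_prod_sub`). Multiplication by `T` preserves the ideal, so
the factors of `T^{⊗r}` can be replaced one at a time. A permutation of `r + 1` points arises from
one of `r` points either by adding a fixed point (factor `μ + λp`) or by inserting the new point
into an existing cycle (factor `λ`). Hence `T^{⊗r} ≡ W S^{⊗r}` with `W = ∑_σ λ^(r−|σ|) (μ+λp)^|σ|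
ρ(σ) = λ^r ∑_σ c^|σ| ρ(σ)` (`inStarIdeal_prod_tEntry_sub`). Modulo `λ` only the identity permutation
survives, so `W` is invertible over `ℂ[[λ]]`, and `W⁻¹ T^{⊗r}` is a homogeneous part of `S^{⊗r}`.
The asserted formula is `W P(S^{⊗r}) = T^{⊗r}`.

Uniqueness. A homogeneous `f` in the ideal has to vanish
(`eq_zero_of_isHomogeneous_of_inStarIdeal`). On the orbit `g ↦ zg` its coefficients are constants
with `f_n = k_n + ∑ E_{ij} G_{n−1,ij}`, where `k_n = ∑ G_{n,ij} (x−μ)_{ji}`. The weight `ψ = |det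
g|² exp(−tr x/μ)` satisfies `E_{ij} ψ = −μ⁻¹ ψ (x−μ)_{ji}`, so integrating by parts against `h(ψ)
exp(−p tr x/μ)` turns the derivative term into `μ⁻¹ ∫ k_{n−1}` against the same expression with `h`
replaced by `s h' + p h`. Inductively this integral is zero, so `f_n − k_n` integrates to zero
against every such test function. Concentrating `h` near the maximum of `ψ`, where `x = μ` and
therefore `k_n = 0`, forces `f_n = 0`; then `k_n` integrates to zero too and the induction
continues. -/

/-- Full rank becomes the non-vanishing of a continuous function, hence an open condition, and `x`
is invertible on the whole phase space. -/
lemma rank_eq_iff_det_xMat_ne_zero {m p : ℕ} (w : Matrix (Fin m) (Fin p) ℂ) :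
    w.rank = p ↔ (w.conjTranspose * w).det ≠ 0 := by
  rw [← Matrix.rank_conjTranspose_mul_self]
  constructor
  · intro h
    have hli : LinearIndependent ℂ (wᴴ * w).col := by
      rw [linearIndependent_iff_card_eq_finrank_span, Set.finrank, Fintype.card_fin,
        ← Matrix.rank_eq_finrank_span_cols, h]
    exact ((Matrix.isUnit_iff_isUnit_det _).1
      (Matrix.linearIndependent_cols_iff_isUnit.1 hli)).ne_zero
  · intro h
    rw [Matrix.rank_of_isUnit _ ((Matrix.isUnit_iff_isUnit_det _).2 (isUnit_iff_ne_zero.2 h)),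
      Fintype.card_fin]

lemma isUnit_det_xMat (z : PhaseSpace p q) : IsUnit (xMat z.1).det :=
  isUnit_iff_ne_zero.2 ((rank_eq_iff_det_xMat_ne_zero z.1).1 z.2)

lemma isOpen_rank_eq (m p : ℕ) : IsOpen {w : Matrix (Fin m) (Fin p) ℂ | w.rank = p} := by
  simp only [rank_eq_iff_det_xMat_ne_zero]
  refine isOpen_ne_fun ?_ continuous_const
  fun_prop

lemma rank_eq_mem_nhds (z : PhaseSpace p q) :
    {w : Matrix (Fin (p + q)) (Fin p) ℂ | w.rank = p} ∈ 𝓝 z.1 :=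
  (isOpen_rank_eq _ _).mem_nhds z.2

lemma extend_apply (f : PhaseSpace p q → ℂ) (z : PhaseSpace p q) : extend f z.1 = f z := by
  simp [extend, z.2]

/-- The full-rank set is open, so derivatives at its points can be computed from any formula that
agrees with `f` there, whatever the extension does elsewhere. -/
lemma extend_eventuallyEq {f : PhaseSpace p q → ℂ} {F : Matrix (Fin (p + q)) (Fin p) ℂ → ℂ}
    (h : ∀ z : PhaseSpace p q, f z = F z.1) (z : PhaseSpace p q) : extend f =ᶠ[𝓝 z.1] F := by
  filter_upwards [rank_eq_mem_nhds z] with w hw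
  rw [extend_apply f ⟨w, hw⟩, h]

lemma extend_add (f g : PhaseSpace p q → ℂ) : extend (f + g) = extend f + extend g := by
  ext w; by_cases h : w.rank = p <;> simp [extend, h]

lemma extend_mul (f g : PhaseSpace p q → ℂ) : extend (f * g) = extend f * extend g := by
  ext w; by_cases h : w.rank = p <;> simp [extend, h]

/-! ### Smooth functions -/

lemma isSmooth_of_contDiffOn {f : PhaseSpace p q → ℂ} {F : Matrix (Fin (p + q)) (Fin p) ℂ → ℂ}
    (h : ∀ z : PhaseSpace p q, f z = F z.1) (hF : ContDiffOn ℝ ∞ F {w | w.rank = p}) :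
    IsSmooth f :=
  hF.congr fun w hw => by rw [extend_apply f ⟨w, hw⟩, h]

lemma IsSmooth.contDiffAt {f : PhaseSpace p q → ℂ} (hf : IsSmooth f) (z : PhaseSpace p q) :
    ContDiffAt ℝ ∞ (extend f) z.1 :=
  ContDiffOn.contDiffAt hf (rank_eq_mem_nhds z)

lemma IsSmooth.differentiableAt {f : PhaseSpace p q → ℂ} (hf : IsSmooth f)
    (z : PhaseSpace p q) : DifferentiableAt ℝ (extend f) z.1 :=
  (hf.contDiffAt z).differentiableAt (by simp)

lemma isSmooth_const (c : ℂ) : IsSmooth (fun _ : PhaseSpace p q => c) :=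
  isSmooth_of_contDiffOn (F := fun _ => c) (fun _ => rfl) contDiffOn_const

lemma isSmooth_zero : IsSmooth (0 : PhaseSpace p q → ℂ) := isSmooth_const 0

lemma IsSmooth.add {f g : PhaseSpace p q → ℂ} (hf : IsSmooth f) (hg : IsSmooth g) :
    IsSmooth (f + g) := by
  rw [IsSmooth, extend_add]; exact ContDiffOn.add hf hg

lemma IsSmooth.mul {f g : PhaseSpace p q → ℂ} (hf : IsSmooth f) (hg : IsSmooth g) :
    IsSmooth (f * g) := by
  rw [IsSmooth, extend_mul]; exact ContDiffOn.mul hf hg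

lemma IsSmooth.const_smul {f : PhaseSpace p q → ℂ} (c : ℂ) (hf : IsSmooth f) :
    IsSmooth (c • f) :=
  (isSmooth_const c).mul hf

lemma isSmooth_sum {ι : Type*} {s : Finset ι} {f : ι → PhaseSpace p q → ℂ}
    (h : ∀ k ∈ s, IsSmooth (f k)) : IsSmooth (∑ k ∈ s, f k) :=
  Finset.sum_induction f IsSmooth (fun _ _ => IsSmooth.add) isSmooth_zero h

lemma isSmooth_prod {ι : Type*} {s : Finset ι} {f : ι → PhaseSpace p q → ℂ}
    (h : ∀ k ∈ s, IsSmooth (f k)) : IsSmooth (∏ k ∈ s, f k) :=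
  Finset.prod_induction f IsSmooth (fun _ _ => IsSmooth.mul) (isSmooth_const 1) h

lemma contDiff_matrix_apply {m n : ℕ} (A : Fin m) (i : Fin n) :
    ContDiff ℝ ∞ fun w : Matrix (Fin m) (Fin n) ℂ => w A i :=
  (contDiff_apply_apply ℝ ℂ A i : ContDiff ℝ ∞ fun w : Fin m → Fin n → ℂ => w A i)

lemma contDiff_conj_matrix_apply {m n : ℕ} (A : Fin m) (i : Fin n) :
    ContDiff ℝ ∞ fun w : Matrix (Fin m) (Fin n) ℂ => star (w A i) :=
  Complex.conjCLE.contDiff.comp (contDiff_matrix_apply A i)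

lemma contDiff_det {E : Type*} [NormedAddCommGroup E] [NormedSpace ℝ E] {n : ℕ}
    {M : E → Matrix (Fin n) (Fin n) ℂ} (h : ∀ i j, ContDiff ℝ ∞ fun w => M w i j) :
    ContDiff ℝ ∞ fun w => (M w).det := by
  simp only [Matrix.det_apply']
  exact ContDiff.sum fun σ _ => contDiff_const.mul (contDiff_prod fun k _ => h _ _)

lemma contDiff_xMat {m p : ℕ} (i j : Fin p) :
    ContDiff ℝ ∞ fun w : Matrix (Fin m) (Fin p) ℂ => (w.conjTranspose * w) i j := by
  simp only [Matrix.mul_apply, Matrix.conjTranspose_apply]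
  exact ContDiff.sum fun A _ => (contDiff_conj_matrix_apply A i).mul (contDiff_matrix_apply A j)

lemma contDiffOn_xMat_inv (i j : Fin p) :
    ContDiffOn ℝ ∞ (fun w : Matrix (Fin (p + q)) (Fin p) ℂ => (xMat w)⁻¹ i j)
      {w | w.rank = p} := by
  have hdet : ContDiff ℝ ∞ fun w : Matrix (Fin (p + q)) (Fin p) ℂ => (xMat w).det :=
    contDiff_det contDiff_xMat
  have hadj : ContDiff ℝ ∞ fun w : Matrix (Fin (p + q)) (Fin p) ℂ => (xMat w).adjugate i j := by
    simp only [Matrix.adjugate_apply]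
    refine contDiff_det fun a b => ?_
    by_cases hab : a = j
    · subst hab
      simp only [Matrix.updateRow_self]
      exact contDiff_const
    · simp only [Matrix.updateRow_ne hab]
      exact contDiff_xMat a b
  simp only [Matrix.inv_def, Matrix.smul_apply, Ring.inverse_eq_inv', smul_eq_mul]
  refine ContDiffOn.mul (hdet.contDiffOn.inv fun w hw => ?_) hadj.contDiffOn
  exact (rank_eq_iff_det_xMat_ne_zero w).1 hw

/-! ### The holomorphic part of the derivative -/

/-- The complex linear part of the real derivative of `F` at `w`. -/
def holDeriv {E : Type*} [NormedAddCommGroup E] [NormedSpace ℝ E] [NormedSpace ℂ E] (F : E → ℂ) (w v : E) : ℂ :=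
  (1 / 2 : ℂ) * (fderiv ℝ F w v - Complex.I * fderiv ℝ F w (Complex.I • v))

section holDeriv

set_option linter.unusedSectionVars false

variable {E : Type*} [NormedAddCommGroup E] [NormedSpace ℝ E] [NormedSpace ℂ E] [IsScalarTower ℝ ℂ E]
  {F G : E → ℂ} {w : E}

lemma holDeriv_congr (h : F =ᶠ[𝓝 w] G) (v : E) : holDeriv F w v = holDeriv G w v := by
  simp only [holDeriv, h.fderiv_eq]

lemma holDeriv_add_right (v v' : E) : holDeriv F w (v + v') = holDeriv F w v + holDeriv F w v' := by
  simp only [holDeriv, smul_add, map_add]; ring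

/-- The combination `dF(v) − i dF(iv)` projects the real differential onto its complex-linear part;
the proof splits `c` into real and imaginary parts. -/
lemma holDeriv_smul_right (c : ℂ) (v : E) : holDeriv F w (c • v) = c * holDeriv F w v := by
  have hr (r : ℝ) (u : E) : (r : ℂ) • u = r • u := by
    rw [← mul_one (r : ℂ), ← Complex.real_smul, smul_assoc, one_smul]
  have h : c • v = c.re • v + c.im • (Complex.I • v) := by
    conv_lhs => rw [← Complex.re_add_im c, add_smul, mul_smul]
    rw [hr, hr]
  have h2 : Complex.I • c • v = c.re • (Complex.I • v) - c.im • v := by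
    conv_lhs => rw [← Complex.re_add_im c, add_smul, smul_add, ← mul_smul, ← mul_smul]
    rw [sub_eq_add_neg, ← hr c.im, ← neg_smul]
    have : Complex.I * (c.im * Complex.I) = -(c.im : ℂ) := by
      linear_combination (c.im : ℂ) * Complex.I_mul_I
    rw [this, mul_comm, mul_smul, hr]
  rw [holDeriv, holDeriv, h2, h]
  simp only [map_add, map_sub, map_smul, Complex.real_smul]
  conv_rhs => rw [← Complex.re_add_im c]
  linear_combination ((1 / 2) * (c.im : ℂ) * fderiv ℝ F w (Complex.I • v)) * Complex.I_mul_I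

lemma holDeriv_sum_right {ι : Type*} (s : Finset ι) (v : ι → E) :
    holDeriv F w (∑ k ∈ s, v k) = ∑ k ∈ s, holDeriv F w (v k) :=
  map_sum (⟨⟨holDeriv F w, by simpa using holDeriv_smul_right (F := F) (w := w) 0 0⟩,
    holDeriv_add_right⟩ : E →+ ℂ) v s

lemma holDeriv_const (c : ℂ) (v : E) : holDeriv (fun _ => c) w v = 0 := by
  simp [holDeriv]

lemma holDeriv_add (hF : DifferentiableAt ℝ F w) (hG : DifferentiableAt ℝ G w) (v : E) :
    holDeriv (F + G) w v = holDeriv F w v + holDeriv G w v := by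
  simp only [holDeriv, fderiv_add hF hG, _root_.add_apply]; ring

lemma holDeriv_mul (hF : DifferentiableAt ℝ F w) (hG : DifferentiableAt ℝ G w) (v : E) :
    holDeriv (F * G) w v = F w * holDeriv G w v + holDeriv F w v * G w := by
  simp only [holDeriv, fderiv_mul hF hG, _root_.add_apply,
    _root_.smul_apply, smul_eq_mul]
  ring

lemma holDeriv_sum {ι : Type*} {s : Finset ι} {f : ι → E → ℂ}
    (h : ∀ k ∈ s, DifferentiableAt ℝ (f k) w) (v : E) :
    holDeriv (fun u => ∑ k ∈ s, f k u) w v = ∑ k ∈ s, holDeriv (f k) w v := by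
  simp only [holDeriv, fderiv_fun_sum h, _root_.sum_apply, Finset.mul_sum,
    ← Finset.sum_sub_distrib]

lemma holDeriv_linear (ℓ : E →L[ℂ] ℂ) (v : E) : holDeriv ℓ w v = ℓ v := by
  have : fderiv ℝ ℓ w = ℓ.restrictScalars ℝ := (ℓ.restrictScalars ℝ).fderiv
  simp only [holDeriv, this, ContinuousLinearMap.coe_restrictScalars', map_smul, smul_eq_mul]
  linear_combination (-(1 / 2) * ℓ v) * Complex.I_mul_I

lemma holDeriv_conj_linear (ℓ : E →L[ℂ] ℂ) (v : E) :
    holDeriv (fun u => star (ℓ u)) w v = 0 := by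
  have : fderiv ℝ (fun u => star (ℓ u)) w
      = (Complex.conjCLE : ℂ →L[ℝ] ℂ).comp (ℓ.restrictScalars ℝ) :=
    ((Complex.conjCLE : ℂ →L[ℝ] ℂ).comp (ℓ.restrictScalars ℝ)).fderiv
  simp only [holDeriv, this, ContinuousLinearMap.comp_apply,
    ContinuousLinearMap.coe_restrictScalars', map_smul, smul_eq_mul,
    ContinuousLinearEquiv.coe_coe, Complex.conjCLE_apply, map_mul, Complex.conj_I]
  linear_combination (1 / 2 * (starRingEnd ℂ) (ℓ v)) * Complex.I_mul_I

end holDeriv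

/-- The `(A, i)` entry as a continuous linear functional. -/
def entryCLM {m n : ℕ} (A : Fin m) (i : Fin n) : Matrix (Fin m) (Fin n) ℂ →L[ℂ] ℂ :=
  LinearMap.toContinuousLinearMap (Matrix.entryLinearMap ℂ ℂ A i)

lemma holDeriv_entry {m n : ℕ} (A : Fin m) (i : Fin n) (w v : Matrix (Fin m) (Fin n) ℂ) :
    holDeriv (fun u : Matrix (Fin m) (Fin n) ℂ => u A i) w v = v A i :=
  holDeriv_linear (entryCLM A i) v

lemma holDeriv_conj_entry {m n : ℕ} (A : Fin m) (i : Fin n) (w v : Matrix (Fin m) (Fin n) ℂ) :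
    holDeriv (fun u : Matrix (Fin m) (Fin n) ℂ => star (u A i)) w v = 0 :=
  holDeriv_conj_linear (entryCLM A i) v

lemma mul_single_eq_sum {m p : ℕ} (w : Matrix (Fin m) (Fin p) ℂ) (i j : Fin p) :
    w * (Matrix.single i j 1 : Matrix (Fin p) (Fin p) ℂ) =
      ∑ A, w A i • (Matrix.single A j 1 : Matrix (Fin m) (Fin p) ℂ) := by
  ext B k
  simp only [Matrix.mul_apply, Matrix.sum_apply, Matrix.smul_apply, Matrix.single_apply,
    smul_eq_mul, mul_ite, mul_one, mul_zero]
  by_cases h : j = k <;> simp [h]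

/-- Complex linearity in the direction identifies the Wirtinger operator `∑_A z_{Ai} ∂/∂z_{Aj}` with
differentiation along the fundamental vector `w e_{ij}` of the right action. -/
lemma holDeriv_mul_single {m p : ℕ} (F : Matrix (Fin m) (Fin p) ℂ → ℂ)
    (w : Matrix (Fin m) (Fin p) ℂ) (i j : Fin p) :
    holDeriv F w (w * (Matrix.single i j 1 : Matrix (Fin p) (Fin p) ℂ)) =
      ∑ A, w A i * holDeriv F w (Matrix.single A j 1 : Matrix (Fin m) (Fin p) ℂ) := by
  rw [mul_single_eq_sum]
  refine (holDeriv_sum_right _ _).trans (Finset.sum_congr rfl fun A _ => ?_)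
  exact holDeriv_smul_right _ _

lemma dz_eq_holDeriv (A : Fin (p + q)) (i : Fin p) (f : PhaseSpace p q → ℂ)
    (z : PhaseSpace p q) : dz A i f z = holDeriv (extend f) z.1 (Matrix.single A i 1) := by
  rw [dz, holDeriv, Matrix.smul_single, smul_eq_mul, mul_one]
  rfl

end GrassmannStar

end

/-! ### Star multiplication by the moment map -/

noncomputable section

namespace GrassmannStar

open Matrix Topology
open scoped ComplexOrder

variable {p q : ℕ}

/-! ### The star product with the moment map -/

/-- The complex antilinear part of the real derivative of `F` at `w`. -/
def antiDeriv {E : Type*} [NormedAddCommGroup E] [NormedSpace ℝ E] [NormedSpace ℂ E] (F : E → ℂ)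
    (w v : E) : ℂ :=
  (1 / 2 : ℂ) * (fderiv ℝ F w v + Complex.I * fderiv ℝ F w (Complex.I • v))

lemma antiDeriv_eq_sub {E : Type*} [NormedAddCommGroup E] [NormedSpace ℝ E] [NormedSpace ℂ E]
    (F : E → ℂ) (w v : E) : antiDeriv F w v = fderiv ℝ F w v - holDeriv F w v := by
  rw [antiDeriv, holDeriv]; ring

lemma dzbar_eq_antiDeriv (A : Fin (p + q)) (i : Fin p) {f : PhaseSpace p q → ℂ}
    {F : Matrix (Fin (p + q)) (Fin p) ℂ → ℂ} (h : ∀ z : PhaseSpace p q, f z = F z.1)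
    (z : PhaseSpace p q) : dzbar A i f z = antiDeriv F z.1 (Matrix.single A i 1) := by
  rw [antiDeriv, Matrix.smul_single, smul_eq_mul, mul_one, dzbar,
    (extend_eventuallyEq h z).fderiv_eq]
  rfl

lemma dzbar_zero (A : Fin (p + q)) (i : Fin p) : dzbar A i (0 : PhaseSpace p q → ℂ) = 0 := by
  ext z
  refine (dzbar_eq_antiDeriv (F := fun _ => 0) A i (fun _ => rfl) z).trans ?_
  simp [antiDeriv]

lemma fderiv_conj_entry {m n : ℕ} (A : Fin m) (i : Fin n) (w v : Matrix (Fin m) (Fin n) ℂ) :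
    fderiv ℝ (fun u : Matrix (Fin m) (Fin n) ℂ => star (u A i)) w v = star (v A i) := by
  have : fderiv ℝ (fun u : Matrix (Fin m) (Fin n) ℂ => star (u A i)) w
      = (Complex.conjCLE : ℂ →L[ℝ] ℂ).comp ((entryCLM A i).restrictScalars ℝ) :=
    ((Complex.conjCLE : ℂ →L[ℝ] ℂ).comp ((entryCLM A i).restrictScalars ℝ)).fderiv
  rw [this]; rfl

lemma fderiv_entry {m n : ℕ} (A : Fin m) (i : Fin n) (w v : Matrix (Fin m) (Fin n) ℂ) :
    fderiv ℝ (fun u : Matrix (Fin m) (Fin n) ℂ => u A i) w v = v A i := by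
  have : fderiv ℝ (fun u : Matrix (Fin m) (Fin n) ℂ => u A i) w
      = (entryCLM A i).restrictScalars ℝ := ((entryCLM A i).restrictScalars ℝ).fderiv
  rw [this]; rfl

lemma differentiable_entry {m n : ℕ} (A : Fin m) (i : Fin n) :
    Differentiable ℝ fun u : Matrix (Fin m) (Fin n) ℂ => u A i :=
  (contDiff_matrix_apply A i).differentiable (by simp)

lemma differentiable_conj_entry {m n : ℕ} (A : Fin m) (i : Fin n) :
    Differentiable ℝ fun u : Matrix (Fin m) (Fin n) ℂ => star (u A i) :=
  (contDiff_conj_matrix_apply A i).differentiable (by simp)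

lemma holDeriv_conjTranspose_mul {m n : ℕ} (i j : Fin n) (w v : Matrix (Fin m) (Fin n) ℂ) :
    holDeriv (fun u : Matrix (Fin m) (Fin n) ℂ => (uᴴ * u) i j) w v = (wᴴ * v) i j := by
  simp only [Matrix.mul_apply, Matrix.conjTranspose_apply]
  refine (holDeriv_sum (f := fun A (u : Matrix (Fin m) (Fin n) ℂ) => star (u A i) * u A j)
    (fun A _ => ((differentiable_conj_entry A i).mul (differentiable_entry A j)) w) v).trans ?_
  refine Finset.sum_congr rfl fun A _ => ?_
  refine (holDeriv_mul (differentiable_conj_entry A i w) (differentiable_entry A j w) v).trans ?_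
  rw [holDeriv_conj_entry, holDeriv_entry, zero_mul, add_zero]

lemma fderiv_conjTranspose_mul {m n : ℕ} (i j : Fin n) (w v : Matrix (Fin m) (Fin n) ℂ) :
    fderiv ℝ (fun u : Matrix (Fin m) (Fin n) ℂ => (uᴴ * u) i j) w v =
      (wᴴ * v) i j + (vᴴ * w) i j := by
  simp only [Matrix.mul_apply, Matrix.conjTranspose_apply]
  refine (DFunLike.congr_fun (fderiv_fun_sum
    (A := fun A (u : Matrix (Fin m) (Fin n) ℂ) => star (u A i) * u A j)
    (fun A _ => ((differentiable_conj_entry A i).mul (differentiable_entry A j)) w)) v).trans ?_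
  rw [_root_.sum_apply, ← Finset.sum_add_distrib]
  refine Finset.sum_congr rfl fun A _ => ?_
  refine (DFunLike.congr_fun
    (fderiv_fun_mul (differentiable_conj_entry A i w) (differentiable_entry A j w)) v).trans ?_
  rw [_root_.add_apply, _root_.smul_apply, _root_.smul_apply, smul_eq_mul, smul_eq_mul]
  refine congrArg₂ _ (congrArg₂ _ rfl (fderiv_entry A j w v)) ?_
  exact (congrArg₂ _ rfl (fderiv_conj_entry A i w v)).trans (mul_comm _ _)

/-- The entries of `x - μ`. -/
def momentEntry (μ : ℝ) (j i : Fin p) : PhaseSpace p q → ℂ :=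
  fun z => (xMat z.1 - (μ : ℂ) • (1 : Matrix (Fin p) (Fin p) ℂ)) j i

lemma dzbar_momentEntry (μ : ℝ) (j i : Fin p) (A : Fin (p + q)) (k : Fin p) :
    dzbar A k (momentEntry μ j i) = fun z => if k = j then z.1 A i else 0 := by
  ext z
  refine (dzbar_eq_antiDeriv
    (F := fun u => (uᴴ * u) j i - ((μ : ℂ) • (1 : Matrix (Fin p) (Fin p) ℂ)) j i)
    A k (fun _ => rfl) z).trans ?_
  -- The antilinear part is the full differential minus its linear part; of the two Leibniz terms of
  -- `u†u` this leaves the one in which `u†` is varied.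
  rw [antiDeriv_eq_sub]
  have h1 := (contDiff_xMat (m := p + q) (p := p) j i).differentiable (by simp) z.1
  have h2 : holDeriv (fun u : Matrix (Fin (p + q)) (Fin p) ℂ =>
      (uᴴ * u) j i - ((μ : ℂ) • (1 : Matrix (Fin p) (Fin p) ℂ)) j i) z.1 (single A k 1)
      = (z.1ᴴ * (single A k 1 : Matrix (Fin (p + q)) (Fin p) ℂ)) j i := by
    simp only [sub_eq_add_neg]
    refine (holDeriv_add h1 (differentiableAt_const _) _).trans ?_
    rw [holDeriv_conjTranspose_mul, holDeriv_const, add_zero]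
  rw [h2, fderiv_sub_const]
  refine (congrArg₂ _ (fderiv_conjTranspose_mul j i z.1 _) rfl).trans ?_
  rw [add_sub_cancel_left]
  simp only [Matrix.mul_apply, Matrix.conjTranspose_apply, Matrix.single_apply]
  rw [Finset.sum_eq_single A]
  · by_cases h : k = j <;> simp [h]
  · intro B _ hB
    simp [hB.symm]
  · simp

lemma dzbar_dzbar_momentEntry (μ : ℝ) (j i : Fin p) (A B : Fin (p + q)) (k l : Fin p) :
    dzbar B l (dzbar A k (momentEntry μ j i)) = 0 := by
  rw [dzbar_momentEntry]
  by_cases h : k = j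
  · ext z
    refine (dzbar_eq_antiDeriv (F := fun u => u A i) B l (fun _ => by simp [h]) z).trans ?_
    rw [antiDeriv_eq_sub]
    exact sub_eq_zero.2 ((fderiv_entry A i _ _).trans (holDeriv_entry A i _ _).symm)
  · simp only [h, if_false]
    exact dzbar_zero B l

lemma wickBidiff_zero_right (n : ℕ) (f : PhaseSpace p q → ℂ) : wickBidiff n f 0 = 0 := by
  induction n generalizing f with
  | zero => simp [wickBidiff]
  | succ n ih => simp [wickBidiff, dzbar_zero, ih]

/-- The infinitesimal generator `∑_A z^A_i ∂/∂z^A_j` of the right action. -/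
def euler (i j : Fin p) (f : PhaseSpace p q → ℂ) : PhaseSpace p q → ℂ :=
  fun z => ∑ A, z.1 A i * dz A j f z

lemma euler_eq_holDeriv (i j : Fin p) (f : PhaseSpace p q → ℂ) (z : PhaseSpace p q) :
    euler i j f z = holDeriv (extend f) z.1
      (z.1 * (Matrix.single i j 1 : Matrix (Fin p) (Fin p) ℂ)) := by
  rw [holDeriv_mul_single]
  simp only [← dz_eq_holDeriv]
  rfl

lemma wickBidiff_one_momentEntry (μ : ℝ) (j i : Fin p) (f : PhaseSpace p q → ℂ) :
    wickBidiff 1 f (momentEntry μ j i) = euler i j f := by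
  ext z
  simp only [wickBidiff, dzbar_momentEntry, euler, Finset.sum_apply, Pi.mul_apply, mul_ite,
    mul_zero, Finset.sum_ite_eq', Finset.mem_univ, if_true]
  exact Finset.sum_congr rfl fun A _ => mul_comm _ _

lemma wickBidiff_add_two_momentEntry (μ : ℝ) (j i : Fin p) (n : ℕ) (f : PhaseSpace p q → ℂ) :
    wickBidiff (n + 2) f (momentEntry μ j i) = 0 := by
  simp [wickBidiff, dzbar_dzbar_momentEntry, wickBidiff_zero_right]

/-- `euler` applied to every coefficient of a formal function. -/
def eulerFormal (i j : Fin p) (F : FormalFun p q) : FormalFun p q :=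
  PowerSeries.mk fun n => euler i j (PowerSeries.coeff n F)

lemma coeff_wickStar_C (F : FormalFun p q) (g : PhaseSpace p q → ℂ) (n : ℕ) :
    PowerSeries.coeff n (wickStar F (PowerSeries.C g)) =
      ∑ a ∈ Finset.HasAntidiagonal.antidiagonal n,
        ((a.1.factorial : ℂ)⁻¹) • wickBidiff a.1 (PowerSeries.coeff a.2 F) g := by
  rw [wickStar, PowerSeries.coeff_mk]
  refine Finset.sum_congr rfl fun a _ => ?_
  rw [Finset.sum_eq_single (a.2, 0)]
  · simp
  · rintro ⟨b, c⟩ hb hne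
    have hc : c ≠ 0 := by
      rintro rfl
      exact hne (by rw [← Finset.HasAntidiagonal.mem_antidiagonal.1 hb, add_zero])
    rw [PowerSeries.coeff_C, if_neg hc, wickBidiff_zero_right, smul_zero]
  · simp

/-- `x − μ` is affine in `z̄`, so orders two and above vanish, while the first-order contraction is
exactly the generator `euler i j`. -/
lemma wickStar_xSub (μ : ℝ) (j i : Fin p) (F : FormalFun p q) :
    wickStar F (xSub μ j i) =
      F * PowerSeries.C (momentEntry μ j i) + PowerSeries.X * eulerFormal i j F := by
  ext1 n
  refine (coeff_wickStar_C F (momentEntry μ j i) n).trans ?_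
  rw [map_add, PowerSeries.coeff_mul_C]
  rcases n with _ | n
  · simp [wickBidiff]
  -- Splitting off order zero shifts the first index by one: the surviving pair `(0, n)` is the
  -- first-order operator on coefficient `n`.
  · rw [PowerSeries.coeff_succ_X_mul, Finset.Nat.antidiagonal_succ, Finset.sum_cons, Finset.sum_map,
      Finset.sum_eq_single (0, n)]
    · simp only [Nat.factorial_zero, Nat.cast_one, inv_one, one_smul, wickBidiff,
        Function.Embedding.prodMap, Function.Embedding.coeFn_mk, Prod.map_apply,
        Function.Embedding.refl_apply, Nat.succ_eq_add_one, zero_add, Nat.factorial_one,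
        eulerFormal, PowerSeries.coeff_mk]
      rw [← wickBidiff_one_momentEntry μ j i]
      rfl
    · rintro ⟨_ | a, b⟩ hab hne
      · exact absurd (by rw [← Finset.HasAntidiagonal.mem_antidiagonal.1 hab, zero_add]) hne
      · exact (congrArg _ (wickBidiff_add_two_momentEntry μ j i a _)).trans (smul_zero _)
    · simp

end GrassmannStar

end

/-! ### The holomorphic generators and their values on the entries of S and T -/

noncomputable section

namespace GrassmannStar

open Matrix Topology
open scoped ComplexOrder

variable {p q : ℕ}

/-! ### The generators of the right action as derivations -/

lemma euler_eq_of_eq {f : PhaseSpace p q → ℂ} {F : Matrix (Fin (p + q)) (Fin p) ℂ → ℂ}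
    (h : ∀ z : PhaseSpace p q, f z = F z.1) (i j : Fin p) (z : PhaseSpace p q) :
    euler i j f z = holDeriv F z.1 (z.1 * (Matrix.single i j 1 : Matrix (Fin p) (Fin p) ℂ)) := by
  rw [euler_eq_holDeriv, holDeriv_congr (extend_eventuallyEq h z)]

lemma euler_const (i j : Fin p) (c : ℂ) : euler i j (fun _ : PhaseSpace p q => c) = 0 := by
  ext z
  rw [euler_eq_of_eq (F := fun _ => c) fun _ => rfl, holDeriv_const, Pi.zero_apply]

lemma euler_add (i j : Fin p) {f g : PhaseSpace p q → ℂ} (hf : IsSmooth f) (hg : IsSmooth g) :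
    euler i j (f + g) = euler i j f + euler i j g := by
  ext z
  simp only [euler_eq_holDeriv, extend_add, Pi.add_apply]
  exact holDeriv_add (hf.differentiableAt z) (hg.differentiableAt z) _

lemma euler_mul (i j : Fin p) {f g : PhaseSpace p q → ℂ} (hf : IsSmooth f) (hg : IsSmooth g) :
    euler i j (f * g) = f * euler i j g + euler i j f * g := by
  ext z
  simp only [euler_eq_holDeriv, extend_mul, Pi.add_apply, Pi.mul_apply]
  rw [holDeriv_mul (hf.differentiableAt z) (hg.differentiableAt z), extend_apply, extend_apply]

lemma euler_smul (i j : Fin p) (c : ℂ) {f : PhaseSpace p q → ℂ} (hf : IsSmooth f) :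
    euler i j (c • f) = c • euler i j f := by
  refine (euler_mul i j (isSmooth_const c) hf).trans ?_
  rw [euler_const, zero_mul, add_zero]
  rfl

lemma euler_sum (i j : Fin p) {ι : Type*} (s : Finset ι) {f : ι → PhaseSpace p q → ℂ}
    (h : ∀ k, IsSmooth (f k)) : euler i j (∑ k ∈ s, f k) = ∑ k ∈ s, euler i j (f k) := by
  classical
  induction s using Finset.induction_on with
  | empty => exact euler_const i j 0
  | insert a s ha ih =>
    rw [Finset.sum_insert ha, Finset.sum_insert ha,
      euler_add i j (h a) (isSmooth_sum fun k _ => h k), ih]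

lemma euler_prod (i j : Fin p) {ι : Type*} [DecidableEq ι] (s : Finset ι)
    {f : ι → PhaseSpace p q → ℂ} (h : ∀ k, IsSmooth (f k)) :
    euler i j (∏ k ∈ s, f k) = ∑ k ∈ s, euler i j (f k) * ∏ l ∈ s.erase k, f l := by
  induction s using Finset.induction_on with
  | empty => exact euler_const i j 1
  | insert a s ha ih =>
    rw [Finset.prod_insert ha, Finset.sum_insert ha,
      euler_mul i j (h a) (isSmooth_prod fun k _ => h k), ih, Finset.erase_insert ha, add_comm,
      Finset.mul_sum]
    refine congrArg₂ _ rfl (Finset.sum_congr rfl fun k hk => ?_)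
    have hka : a ≠ k := fun h => ha (h ▸ hk)
    rw [Finset.erase_insert_of_ne hka, Finset.prod_insert (by simp [ha])]
    ring

/-! ### The matrix valued functions `z x⁻¹`, `x⁻¹ z†`, `z x⁻² z†` and `z x⁻¹ z†` -/

/-- The entries of `z x⁻¹`. -/
def leftInvEntry (A : Fin (p + q)) (i : Fin p) : PhaseSpace p q → ℂ :=
  fun z => (z.1 * (xMat z.1)⁻¹) A i

/-- The entries of `x⁻¹ z†`. -/
def rightInvEntry (i : Fin p) (A : Fin (p + q)) : PhaseSpace p q → ℂ :=
  fun z => ((xMat z.1)⁻¹ * z.1ᴴ) i A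

/-- The entries of `z x⁻² z†`. -/
def sEntry (B A : Fin (p + q)) : PhaseSpace p q → ℂ := fun z => SMat z.1 B A

/-- The entries of the projector `z x⁻¹ z†`. -/
def tEntry (B A : Fin (p + q)) : PhaseSpace p q → ℂ :=
  fun z => (z.1 * (xMat z.1)⁻¹ * z.1ᴴ) B A

/-- The entries of `x`. -/
def xEntry (i j : Fin p) : PhaseSpace p q → ℂ := fun z => xMat z.1 i j

/-- The entries of `z†`. -/
def conjEntry (i : Fin p) (A : Fin (p + q)) : PhaseSpace p q → ℂ := fun z => star (z.1 A i)

/-- The entries of `z`. -/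
def coordEntry (A : Fin (p + q)) (i : Fin p) : PhaseSpace p q → ℂ := fun z => z.1 A i

lemma isSmooth_xEntry (i j : Fin p) : IsSmooth (xEntry i j : PhaseSpace p q → ℂ) :=
  isSmooth_of_contDiffOn (fun _ => rfl) (contDiff_xMat i j).contDiffOn

lemma isSmooth_conjEntry (i : Fin p) (A : Fin (p + q)) : IsSmooth (conjEntry i A) :=
  isSmooth_of_contDiffOn (fun _ => rfl) (contDiff_conj_matrix_apply A i).contDiffOn

lemma isSmooth_coordEntry (A : Fin (p + q)) (i : Fin p) : IsSmooth (coordEntry A i) :=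
  isSmooth_of_contDiffOn (fun _ => rfl) (contDiff_matrix_apply A i).contDiffOn

lemma isSmooth_xMat_inv (i j : Fin p) :
    IsSmooth (fun z : PhaseSpace p q => (xMat z.1)⁻¹ i j) :=
  isSmooth_of_contDiffOn (fun _ => rfl) (contDiffOn_xMat_inv i j)

lemma leftInvEntry_eq_sum (A : Fin (p + q)) (i : Fin p) :
    leftInvEntry A i = ∑ k, coordEntry A k * fun z => (xMat z.1)⁻¹ k i := by
  ext z
  simp [leftInvEntry, coordEntry, Matrix.mul_apply]

lemma rightInvEntry_eq_sum (i : Fin p) (A : Fin (p + q)) :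
    rightInvEntry i A = ∑ k, (fun z => (xMat z.1)⁻¹ i k) * conjEntry k A := by
  ext z
  simp [rightInvEntry, conjEntry, Matrix.mul_apply]

lemma isSmooth_leftInvEntry (A : Fin (p + q)) (i : Fin p) : IsSmooth (leftInvEntry A i) := by
  rw [leftInvEntry_eq_sum]
  exact isSmooth_sum fun k _ => (isSmooth_coordEntry A k).mul (isSmooth_xMat_inv k i)

lemma isSmooth_rightInvEntry (i : Fin p) (A : Fin (p + q)) : IsSmooth (rightInvEntry i A) := by
  rw [rightInvEntry_eq_sum]
  exact isSmooth_sum fun k _ => (isSmooth_xMat_inv i k).mul (isSmooth_conjEntry k A)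

lemma sEntry_eq_sum (B A : Fin (p + q)) :
    sEntry B A = ∑ k, leftInvEntry B k * rightInvEntry k A := by
  ext z
  have : SMat z.1 = (z.1 * (xMat z.1)⁻¹) * ((xMat z.1)⁻¹ * z.1ᴴ) := by
    rw [SMat, pow_two]; simp only [Matrix.mul_assoc]
  simp only [sEntry, this, leftInvEntry, rightInvEntry, Finset.sum_apply, Pi.mul_apply]
  rw [Matrix.mul_apply]

lemma tEntry_eq_sum (B A : Fin (p + q)) :
    tEntry B A = ∑ k, leftInvEntry B k * conjEntry k A := by
  ext z
  simp only [tEntry, leftInvEntry, conjEntry, Finset.sum_apply, Pi.mul_apply]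
  rw [Matrix.mul_apply]
  rfl

lemma isSmooth_sEntry (B A : Fin (p + q)) : IsSmooth (sEntry B A) := by
  rw [sEntry_eq_sum]
  exact isSmooth_sum fun k _ => (isSmooth_leftInvEntry B k).mul (isSmooth_rightInvEntry k A)

lemma isSmooth_tEntry (B A : Fin (p + q)) : IsSmooth (tEntry B A) := by
  rw [tEntry_eq_sum]
  exact isSmooth_sum fun k _ => (isSmooth_leftInvEntry B k).mul (isSmooth_conjEntry k A)

lemma euler_conjEntry (i j k : Fin p) (A : Fin (p + q)) : euler i j (conjEntry k A) = 0 := by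
  ext z
  exact (euler_eq_of_eq (F := fun u => star (u A k)) (fun _ => rfl) i j z).trans
    (holDeriv_conj_entry A k _ _)

lemma euler_coordEntry (i j k : Fin p) (A : Fin (p + q)) :
    euler i j (coordEntry A k) = if k = j then coordEntry A i else 0 := by
  ext z
  refine (euler_eq_of_eq (F := fun u => u A k) (fun _ => rfl) i j z).trans
    ((holDeriv_entry A k _ _).trans ?_)
  by_cases h : k = j
  · subst h; simp [coordEntry]
  · simp [h]

lemma euler_xEntry (i j a k : Fin p) :
    euler i j (xEntry a k : PhaseSpace p q → ℂ) = if k = j then xEntry a i else 0 := by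
  ext z
  refine (euler_eq_of_eq (F := fun u => (uᴴ * u) a k) (fun _ => rfl) i j z).trans
    ((holDeriv_conjTranspose_mul a k _ _).trans ?_)
  rw [← Matrix.mul_assoc]
  by_cases h : k = j
  · subst h; simp [xEntry, xMat]
  · simp [h]

lemma xMat_mul_inv (z : PhaseSpace p q) : xMat z.1 * (xMat z.1)⁻¹ = 1 :=
  Matrix.mul_nonsing_inv _ (isUnit_det_xMat z)

lemma xMat_inv_mul (z : PhaseSpace p q) : (xMat z.1)⁻¹ * xMat z.1 = 1 :=
  Matrix.nonsing_inv_mul _ (isUnit_det_xMat z)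

lemma sum_xEntry_mul_rightInvEntry (a : Fin p) (A : Fin (p + q)) :
    ∑ k, xEntry a k * rightInvEntry k A = conjEntry a A := by
  ext z
  have : xMat z.1 * ((xMat z.1)⁻¹ * z.1ᴴ) = z.1ᴴ := by
    rw [← Matrix.mul_assoc, xMat_mul_inv, Matrix.one_mul]
  have h := congrFun (congrFun this a) A
  rw [Matrix.mul_apply] at h
  simpa [xEntry, rightInvEntry, conjEntry] using h

lemma sum_leftInvEntry_mul_xEntry (A : Fin (p + q)) (a : Fin p) :
    ∑ k, leftInvEntry A k * xEntry k a = coordEntry A a := by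
  ext z
  have : z.1 * (xMat z.1)⁻¹ * xMat z.1 = z.1 := by
    rw [Matrix.mul_assoc, xMat_inv_mul, Matrix.mul_one]
  have h := congrFun (congrFun this A) a
  rw [Matrix.mul_apply] at h
  simpa [xEntry, leftInvEntry, coordEntry] using h

/-- Apply the generator to `x (x⁻¹z†) = z†`. The right side is antiholomorphic, so Leibniz
determines `x` times the unknown vector of derivatives, and the invertible `x` cancels. -/
lemma euler_rightInvEntry (i j k : Fin p) (A : Fin (p + q)) :
    euler i j (rightInvEntry k A) = if k = i then -rightInvEntry j A else 0 := by
  ext z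
  have h (a : Fin p) : ∑ k, xMat z.1 a k * euler i j (rightInvEntry k A) z =
      ∑ k, xMat z.1 a k * (if k = i then -rightInvEntry j A z else 0) := by
    have h0 := congrFun (congrArg (euler i j) (sum_xEntry_mul_rightInvEntry a A)) z
    rw [euler_conjEntry, euler_sum i j _
      fun k => (isSmooth_xEntry a k).mul (isSmooth_rightInvEntry k A)] at h0
    simp only [euler_mul i j (isSmooth_xEntry a _) (isSmooth_rightInvEntry _ A), euler_xEntry,
      Finset.sum_add_distrib, Finset.sum_apply, Pi.add_apply, Pi.mul_apply, Pi.zero_apply,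
      ite_apply, ite_mul, zero_mul, Finset.sum_ite_eq', Finset.mem_univ, if_true] at h0
    simp only [mul_ite, mul_zero, Finset.sum_ite_eq', Finset.mem_univ, if_true]
    simp only [xEntry] at h0
    linear_combination h0
  have hv : xMat z.1 *ᵥ (fun k => euler i j (rightInvEntry k A) z) =
      xMat z.1 *ᵥ (fun k => if k = i then -rightInvEntry j A z else 0) := funext h
  have := congrFun (Matrix.mulVec_injective_of_isUnit
    ((Matrix.isUnit_iff_isUnit_det _).2 (isUnit_det_xMat z)) hv) k
  rw [this]
  by_cases hk : k = i <;> simp [hk]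

/-- Along an orbit `z x⁻¹` becomes `z x⁻¹ (g†)⁻¹`, which is antiholomorphic in `g`. The proof
differentiates `(z x⁻¹) x = z`: the term with `x` differentiated already equals the derivative of
`z`, so the other is zero. -/
lemma euler_leftInvEntry (i j k : Fin p) (A : Fin (p + q)) :
    euler i j (leftInvEntry A k) = 0 := by
  ext z
  have h (a : Fin p) : ∑ k, euler i j (leftInvEntry A k) z * xMat z.1 k a = 0 := by
    have h0 := congrFun (congrArg (euler i j) (sum_leftInvEntry_mul_xEntry A a)) z
    rw [euler_coordEntry, euler_sum i j _
      fun k => (isSmooth_leftInvEntry A k).mul (isSmooth_xEntry k a)] at h0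
    simp only [euler_mul i j (isSmooth_leftInvEntry A _) (isSmooth_xEntry _ a), euler_xEntry,
      Finset.sum_add_distrib, Finset.sum_apply, Pi.add_apply, Pi.mul_apply, Pi.zero_apply,
      ite_apply] at h0
    have h1 := congrFun (sum_leftInvEntry_mul_xEntry A i) z
    simp only [Finset.sum_apply, Pi.mul_apply] at h1
    simp only [xEntry] at h0 h1
    by_cases ha : a = j
    · simp only [ha, if_true] at h0 ⊢
      linear_combination h0 - h1
    · simpa [ha] using h0
  have hv : (fun k => euler i j (leftInvEntry A k) z) ᵥ* xMat z.1 = 0 ᵥ* xMat z.1 := by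
    rw [Matrix.zero_vecMul]; exact funext h
  exact congrFun (Matrix.vecMul_injective_of_isUnit
    ((Matrix.isUnit_iff_isUnit_det _).2 (isUnit_det_xMat z)) hv) k

lemma euler_tEntry (i j : Fin p) (B A : Fin (p + q)) : euler i j (tEntry B A) = 0 := by
  rw [tEntry_eq_sum, euler_sum i j _
    fun k => (isSmooth_leftInvEntry B k).mul (isSmooth_conjEntry k A)]
  simp [euler_mul i j (isSmooth_leftInvEntry B _) (isSmooth_conjEntry _ A), euler_conjEntry,
    euler_leftInvEntry]

lemma euler_sEntry (i j : Fin p) (B A : Fin (p + q)) :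
    euler i j (sEntry B A) = -(leftInvEntry B i * rightInvEntry j A) := by
  rw [sEntry_eq_sum, euler_sum i j _
    fun k => (isSmooth_leftInvEntry B k).mul (isSmooth_rightInvEntry k A)]
  simp [euler_mul i j (isSmooth_leftInvEntry B _) (isSmooth_rightInvEntry _ A),
    euler_rightInvEntry, euler_leftInvEntry]

end GrassmannStar

end

/-! ### The star ideal and the basic congruence -/

noncomputable section

namespace GrassmannStar

open Matrix Topology
open scoped ComplexOrder

variable {p q : ℕ}

/-! ### Behaviour under the right action -/

lemma xMat_act (z : PhaseSpace p q) (g : Matrix.GeneralLinearGroup (Fin p) ℂ) :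
    xMat (z.act g).1 = g.1ᴴ * xMat z.1 * g.1 := by
  simp only [xMat, PhaseSpace.act, Matrix.conjTranspose_mul, Matrix.mul_assoc]

lemma mul_inv_xMat_act (z : PhaseSpace p q) (g : Matrix.GeneralLinearGroup (Fin p) ℂ) :
    (z.act g).1 * (xMat (z.act g).1)⁻¹ = z.1 * (xMat z.1)⁻¹ * (g.1ᴴ)⁻¹ := by
  have hg : g.1 * g.1⁻¹ = 1 :=
    Matrix.mul_nonsing_inv _ ((Matrix.isUnit_iff_isUnit_det _).1 g.isUnit)
  rw [xMat_act, Matrix.mul_inv_rev, Matrix.mul_inv_rev, PhaseSpace.act, Matrix.mul_assoc,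
    ← Matrix.mul_assoc g.1, hg, Matrix.one_mul, Matrix.mul_assoc]

lemma inv_xMat_mul_act (z : PhaseSpace p q) (g : Matrix.GeneralLinearGroup (Fin p) ℂ) :
    (xMat (z.act g).1)⁻¹ * (z.act g).1ᴴ = g.1⁻¹ * ((xMat z.1)⁻¹ * z.1ᴴ) := by
  have hg : (g.1ᴴ)⁻¹ * g.1ᴴ = 1 :=
    Matrix.nonsing_inv_mul _ (by
      rw [Matrix.det_conjTranspose]
      exact ((Matrix.isUnit_iff_isUnit_det _).1 g.isUnit).star)
  rw [xMat_act, Matrix.mul_inv_rev, Matrix.mul_inv_rev, PhaseSpace.act, Matrix.conjTranspose_mul,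
    Matrix.mul_assoc, Matrix.mul_assoc, ← Matrix.mul_assoc _ g.1ᴴ, hg, Matrix.one_mul]

lemma tEntry_act (z : PhaseSpace p q) (g : Matrix.GeneralLinearGroup (Fin p) ℂ)
    (B A : Fin (p + q)) : tEntry B A (z.act g) = tEntry B A z := by
  have hg : g.1 * g.1⁻¹ = 1 :=
    Matrix.mul_nonsing_inv _ ((Matrix.isUnit_iff_isUnit_det _).1 g.isUnit)
  rw [tEntry, tEntry, Matrix.mul_assoc, inv_xMat_mul_act, PhaseSpace.act, Matrix.mul_assoc,
    ← Matrix.mul_assoc g.1, hg, Matrix.one_mul, ← Matrix.mul_assoc]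

lemma unitaryToGL_val (U : Matrix.unitaryGroup (Fin p) ℂ) : (unitaryToGL U).1 = U.1 := rfl

lemma inv_unitary (U : Matrix.unitaryGroup (Fin p) ℂ) : (U.1)⁻¹ = star U.1 :=
  Matrix.inv_eq_left_inv (Unitary.star_mul_self_of_mem U.2)

lemma conjTranspose_inv_unitary (U : Matrix.unitaryGroup (Fin p) ℂ) : (U.1ᴴ)⁻¹ = U.1 :=
  Matrix.inv_eq_left_inv (Unitary.mul_star_self_of_mem U.2)

lemma leftInvEntry_act_unitary (z : PhaseSpace p q) (U : Matrix.unitaryGroup (Fin p) ℂ)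
    (A : Fin (p + q)) (i : Fin p) :
    leftInvEntry A i (z.act (unitaryToGL U)) = ∑ k, leftInvEntry A k z * U.1 k i := by
  rw [leftInvEntry, mul_inv_xMat_act, unitaryToGL_val, conjTranspose_inv_unitary,
    Matrix.mul_apply]
  rfl

lemma rightInvEntry_act_unitary (z : PhaseSpace p q) (U : Matrix.unitaryGroup (Fin p) ℂ)
    (i : Fin p) (A : Fin (p + q)) :
    rightInvEntry i A (z.act (unitaryToGL U)) = ∑ k, (star U.1) i k * rightInvEntry k A z := by
  rw [rightInvEntry, inv_xMat_mul_act, unitaryToGL_val, inv_unitary, Matrix.mul_apply]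
  rfl

lemma sEntry_act_unitary (z : PhaseSpace p q) (U : Matrix.unitaryGroup (Fin p) ℂ)
    (B A : Fin (p + q)) : sEntry B A (z.act (unitaryToGL U)) = sEntry B A z := by
  have h (w : PhaseSpace p q) :
      SMat w.1 = (w.1 * (xMat w.1)⁻¹) * ((xMat w.1)⁻¹ * w.1ᴴ) := by
    rw [SMat, pow_two]; simp only [Matrix.mul_assoc]
  have hU : U.1 * star U.1 = 1 := Unitary.mul_star_self_of_mem U.2
  rw [sEntry, sEntry, h, h, mul_inv_xMat_act, inv_xMat_mul_act, unitaryToGL_val,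
    conjTranspose_inv_unitary, inv_unitary, Matrix.mul_assoc, ← Matrix.mul_assoc U.1, hU,
    Matrix.one_mul]

/-! ### The star ideal -/

/-- Formal power series with constant coefficients as formal functions. -/
def scalar : PowerSeries ℂ →+* FormalFun p q :=
  PowerSeries.map (Pi.constRingHom (PhaseSpace p q) ℂ)

lemma coeff_scalar_mul (a : PowerSeries ℂ) (F : FormalFun p q) (n : ℕ) :
    PowerSeries.coeff n (scalar a * F) = ∑ k ∈ Finset.HasAntidiagonal.antidiagonal n,
      PowerSeries.coeff k.1 a • PowerSeries.coeff k.2 F := by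
  rw [PowerSeries.coeff_mul]
  refine Finset.sum_congr rfl fun k _ => ?_
  rw [scalar, PowerSeries.coeff_map]
  rfl

lemma eulerFormal_add (i j : Fin p) {F G : FormalFun p q}
    (hF : ∀ n, IsSmooth (PowerSeries.coeff n F)) (hG : ∀ n, IsSmooth (PowerSeries.coeff n G)) :
    eulerFormal i j (F + G) = eulerFormal i j F + eulerFormal i j G := by
  ext1 n
  simp only [eulerFormal, map_add, PowerSeries.coeff_mk, euler_add i j (hF n) (hG n)]

lemma eulerFormal_scalar_mul (i j : Fin p) (a : PowerSeries ℂ) {F : FormalFun p q}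
    (hF : ∀ n, IsSmooth (PowerSeries.coeff n F)) :
    eulerFormal i j (scalar a * F) = scalar a * eulerFormal i j F := by
  ext1 n
  rw [coeff_scalar_mul, eulerFormal, PowerSeries.coeff_mk, coeff_scalar_mul,
    euler_sum i j _ (f := fun k : ℕ × ℕ => PowerSeries.coeff k.1 a • PowerSeries.coeff k.2 F)
      fun k => (hF k.2).const_smul _]
  simp only [euler_smul i j _ (hF _), eulerFormal, PowerSeries.coeff_mk]

lemma eulerFormal_C_mul (i j : Fin p) {t : PhaseSpace p q → ℂ} (ht : IsSmooth t)
    (ht0 : euler i j t = 0) {F : FormalFun p q} (hF : ∀ n, IsSmooth (PowerSeries.coeff n F)) :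
    eulerFormal i j (PowerSeries.C t * F) = PowerSeries.C t * eulerFormal i j F := by
  ext1 n
  simp only [eulerFormal, PowerSeries.coeff_mk, PowerSeries.coeff_C_mul,
    euler_mul i j ht (hF n), ht0, zero_mul, add_zero]

lemma inStarIdeal_iff (μ : ℝ) (F : FormalFun p q) : InStarIdeal μ F ↔
    ∃ G : Matrix (Fin p) (Fin p) (FormalFun p q), IsEquivariant G ∧
      F = ∑ i, ∑ j, (G i j * PowerSeries.C (momentEntry μ j i) +
        PowerSeries.X * eulerFormal i j (G i j)) := by
  simp only [InStarIdeal, wickStar_xSub]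

lemma InStarIdeal.add {μ : ℝ} {F F' : FormalFun p q} (hF : InStarIdeal μ F)
    (hF' : InStarIdeal μ F') : InStarIdeal μ (F + F') := by
  rw [inStarIdeal_iff] at *
  obtain ⟨G, hG, rfl⟩ := hF
  obtain ⟨G', hG', rfl⟩ := hF'
  refine ⟨G + G', fun n => ⟨fun i j => ?_, fun z U => ?_⟩, ?_⟩
  · rw [Matrix.add_apply, map_add]
    exact ((hG n).1 i j).add ((hG' n).1 i j)
  · have h (w : PhaseSpace p q) :
        (Matrix.of fun i j => PowerSeries.coeff n ((G + G') i j) w) =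
        (Matrix.of fun i j => PowerSeries.coeff n (G i j) w) +
          Matrix.of fun i j => PowerSeries.coeff n (G' i j) w := by
      ext i j; simp
    rw [h, h, (hG n).2, (hG' n).2, Matrix.mul_add, Matrix.add_mul]
  · simp only [← Finset.sum_add_distrib]
    refine Finset.sum_congr rfl fun i _ => Finset.sum_congr rfl fun j _ => ?_
    rw [Matrix.add_apply, eulerFormal_add i j (fun n => (hG n).1 i j) fun n => (hG' n).1 i j]
    ring

lemma InStarIdeal.scalar_mul {μ : ℝ} (a : PowerSeries ℂ) {F : FormalFun p q}
    (hF : InStarIdeal μ F) : InStarIdeal μ (scalar a * F) := by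
  rw [inStarIdeal_iff] at *
  obtain ⟨G, hG, rfl⟩ := hF
  refine ⟨fun i j => scalar a * G i j, fun n => ⟨fun i j => ?_, fun z U => ?_⟩, ?_⟩
  · rw [coeff_scalar_mul]
    exact isSmooth_sum fun k _ => ((hG _).1 i j).const_smul _
  · have h (w : PhaseSpace p q) :
        (Matrix.of fun i j => PowerSeries.coeff n ((scalar a * G i j : FormalFun p q)) w) =
        ∑ k ∈ Finset.HasAntidiagonal.antidiagonal n, PowerSeries.coeff k.1 a •
          Matrix.of fun i j => PowerSeries.coeff k.2 (G i j) w := by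
      ext i j
      simp [coeff_scalar_mul, Matrix.sum_apply]
    rw [h, h, Matrix.mul_sum, Matrix.sum_mul]
    refine Finset.sum_congr rfl fun k _ => ?_
    rw [(hG k.2).2, Matrix.mul_smul, Matrix.smul_mul]
  · simp only [Finset.mul_sum]
    refine Finset.sum_congr rfl fun i _ => Finset.sum_congr rfl fun j _ => ?_
    rw [eulerFormal_scalar_mul i j a fun n => (hG n).1 i j]
    ring

/-- `T` is invariant, so multiplying `G` by it keeps equivariance, and it is annihilated by the
generators, so it passes through the star product with `x − μ`. -/
lemma InStarIdeal.tEntry_mul {μ : ℝ} (B A : Fin (p + q)) {F : FormalFun p q}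
    (hF : InStarIdeal μ F) : InStarIdeal μ (PowerSeries.C (tEntry B A) * F) := by
  rw [inStarIdeal_iff] at *
  obtain ⟨G, hG, rfl⟩ := hF
  refine ⟨fun i j => PowerSeries.C (tEntry B A) * G i j,
    fun n => ⟨fun i j => ?_, fun z U => ?_⟩, ?_⟩
  · rw [PowerSeries.coeff_C_mul]
    exact (isSmooth_tEntry B A).mul ((hG _).1 i j)
  · have h (w : PhaseSpace p q) :
        (Matrix.of fun i j => PowerSeries.coeff n (PowerSeries.C (tEntry B A) * G i j) w) =
        tEntry B A w • Matrix.of fun i j => PowerSeries.coeff n (G i j) w := by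
      ext i j
      simp
    rw [h, h, (hG n).2, tEntry_act, Matrix.mul_smul, Matrix.smul_mul]
  · simp only [Finset.mul_sum]
    refine Finset.sum_congr rfl fun i _ => Finset.sum_congr rfl fun j _ => ?_
    rw [eulerFormal_C_mul i j (isSmooth_tEntry B A) (euler_tEntry i j B A) fun n => (hG n).1 i j]
    ring

lemma inStarIdeal_zero (μ : ℝ) : InStarIdeal μ (0 : FormalFun p q) := by
  rw [inStarIdeal_iff]
  refine ⟨0, fun n => ⟨fun i j => ?_, fun z U => ?_⟩, ?_⟩
  · simpa using isSmooth_zero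
  · have h (w : PhaseSpace p q) : (Matrix.of fun i j => PowerSeries.coeff n
        ((0 : Matrix (Fin p) (Fin p) (FormalFun p q)) i j) w) = 0 := by
      ext i j; simp
    rw [h, h, Matrix.mul_zero, Matrix.zero_mul]
  · have h (i j : Fin p) : eulerFormal i j (0 : FormalFun p q) = 0 := by
      ext1 n
      rw [eulerFormal, PowerSeries.coeff_mk, map_zero]
      refine Eq.trans ?_ (map_zero (PowerSeries.coeff n)).symm
      exact euler_const i j 0
    simp [h]

lemma InStarIdeal.sum {μ : ℝ} {ι : Type*} {s : Finset ι} {F : ι → FormalFun p q}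
    (h : ∀ k ∈ s, InStarIdeal μ (F k)) : InStarIdeal μ (∑ k ∈ s, F k) :=
  Finset.sum_induction F (InStarIdeal μ) (fun _ _ => InStarIdeal.add) (inStarIdeal_zero μ) h

lemma InStarIdeal.sub {μ : ℝ} {F F' : FormalFun p q} (hF : InStarIdeal μ F)
    (hF' : InStarIdeal μ F') : InStarIdeal μ (F - F') := by
  have h := hF.add (hF'.scalar_mul (-1))
  rwa [map_neg, map_one, neg_one_mul, ← sub_eq_add_neg] at h

/-! ### The basic congruence modulo the star ideal -/

lemma coeff_C_isSmooth {f : PhaseSpace p q → ℂ} (hf : IsSmooth f) (n : ℕ) :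
    IsSmooth (PowerSeries.coeff n (PowerSeries.C f : FormalFun p q)) := by
  rw [PowerSeries.coeff_C]
  split_ifs
  exacts [hf, isSmooth_zero]

lemma eulerFormal_C (i j : Fin p) (f : PhaseSpace p q → ℂ) :
    eulerFormal i j (PowerSeries.C f : FormalFun p q) = PowerSeries.C (euler i j f) := by
  ext1 n
  rw [eulerFormal, PowerSeries.coeff_mk, PowerSeries.coeff_C, PowerSeries.coeff_C]
  split_ifs
  exacts [rfl, euler_const i j 0]

/-- The order-zero part of the congruence: contracting with `x` cancels one of the two inverses in
`z x⁻¹ x⁻¹ z†`, and contracting with `μ` keeps both. -/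
lemma sum_rightInv_mul_leftInv_mul_moment (μ : ℝ) (B A : Fin (p + q)) :
    ∑ i, ∑ j, rightInvEntry i A * leftInvEntry B j * momentEntry μ j i =
      tEntry B A - (μ : ℂ) • sEntry B A := by
  have h1 : ∑ i, ∑ j, rightInvEntry i A * leftInvEntry B j * xEntry j i = tEntry B A := by
    have : ∀ i, ∑ j, rightInvEntry i A * leftInvEntry B j * xEntry j i =
        rightInvEntry i A * coordEntry B i := fun i => by
      rw [← sum_leftInvEntry_mul_xEntry, Finset.mul_sum]
      exact Finset.sum_congr rfl fun j _ => by ring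
    simp only [this]
    ext z
    rw [tEntry, Matrix.mul_assoc, Matrix.mul_apply]
    simp [rightInvEntry, coordEntry, mul_comm]
  have h2 : ∀ i j, rightInvEntry i A * leftInvEntry B j * momentEntry μ j i =
      rightInvEntry i A * leftInvEntry B j * xEntry j i -
        if j = i then (μ : ℂ) • (leftInvEntry B i * rightInvEntry i A) else 0 := fun i j => by
    ext z
    by_cases h : j = i
    · subst h; simp [momentEntry, xEntry]; ring
    · simp [momentEntry, xEntry, h]
  simp only [h2, Finset.sum_sub_distrib, h1, Finset.sum_ite_eq', Finset.mem_univ, if_true,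
    ← Finset.smul_sum, ← sEntry_eq_sum]

/-- The first-order part of the congruence. Differentiating `(x⁻¹z†)_{iA}` yields `−(x⁻¹z†)_{jA}`,
independent of `i`, so the sum over `i` produces the factor `p`. Differentiating a factor `S_{b_k
a_k}` opens it into `(z x⁻¹)_{b_k i}` and `(x⁻¹z†)_{j a_k}`, which close up with the two outer
factors into `S_{b_k A} S_{B a_k}`: a transposition of lower indices. -/
lemma sum_euler_rightInv_mul_leftInv {ι : Type*} [DecidableEq ι] (s : Finset ι)
    (b a : ι → Fin (p + q)) (B A : Fin (p + q)) :
    ∑ i, ∑ j, euler i j (rightInvEntry i A * leftInvEntry B j * ∏ k ∈ s, sEntry (b k) (a k)) =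
      -((p : ℂ) • (sEntry B A * ∏ k ∈ s, sEntry (b k) (a k)) +
        ∑ k ∈ s, sEntry (b k) A * sEntry B (a k) * ∏ l ∈ s.erase k, sEntry (b l) (a l)) := by
  have h1 : ∀ i j, euler i j
      (rightInvEntry i A * leftInvEntry B j * ∏ k ∈ s, sEntry (b k) (a k)) =
      -(leftInvEntry B j * rightInvEntry j A * ∏ k ∈ s, sEntry (b k) (a k)) -
      ∑ k ∈ s, (leftInvEntry (b k) i * rightInvEntry i A) *
        (leftInvEntry B j * rightInvEntry j (a k)) * ∏ l ∈ s.erase k, sEntry (b l) (a l) := by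
    intro i j
    rw [euler_mul i j ((isSmooth_rightInvEntry i A).mul (isSmooth_leftInvEntry B j))
      (isSmooth_prod fun k _ => isSmooth_sEntry _ _),
      euler_mul i j (isSmooth_rightInvEntry i A) (isSmooth_leftInvEntry B j),
      euler_leftInvEntry, euler_rightInvEntry, if_pos rfl,
      euler_prod i j s fun k => isSmooth_sEntry _ _, Finset.mul_sum]
    simp only [euler_sEntry]
    rw [add_comm, sub_eq_add_neg, ← Finset.sum_neg_distrib]
    refine congrArg₂ _ (by ring) (Finset.sum_congr rfl fun k _ => by ring)
  simp only [h1, Finset.sum_sub_distrib, Finset.sum_neg_distrib]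
  rw [neg_add, ← sub_eq_add_neg]
  refine congrArg₂ _ (congrArg _ ?_) ?_
  · simp only [← Finset.sum_mul, ← sEntry_eq_sum, Finset.sum_const, Finset.card_univ,
      Fintype.card_fin]
    rw [Nat.cast_smul_eq_nsmul, smul_mul_assoc]
  · have : ∀ i, ∑ j, ∑ k ∈ s, (leftInvEntry (b k) i * rightInvEntry i A) *
        (leftInvEntry B j * rightInvEntry j (a k)) * ∏ l ∈ s.erase k, sEntry (b l) (a l) =
        ∑ k ∈ s, (leftInvEntry (b k) i * rightInvEntry i A) * sEntry B (a k) *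
          ∏ l ∈ s.erase k, sEntry (b l) (a l) := fun i => by
      rw [Finset.sum_comm]
      refine Finset.sum_congr rfl fun k _ => ?_
      rw [← Finset.sum_mul, ← Finset.mul_sum, ← sEntry_eq_sum]
    simp only [this]
    rw [Finset.sum_comm]
    refine Finset.sum_congr rfl fun k _ => ?_
    rw [← Finset.sum_mul, ← Finset.sum_mul, ← sEntry_eq_sum]

/-- Trades one `T` for one `S` modulo the ideal. The generator `(x⁻¹z†)_{iA} (z x⁻¹)_{Bj} ∏ S` is
equivariant because `x⁻¹z†` acquires `U†` on the left, `z x⁻¹` acquires `U` on the right, and `S` is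
`U(p)`-invariant. -/
lemma inStarIdeal_tEntry_mul_prod_sub (μ : ℝ) {ι : Type*} [DecidableEq ι] (s : Finset ι)
    (b a : ι → Fin (p + q)) (B A : Fin (p + q)) :
    InStarIdeal μ (PowerSeries.C (tEntry B A * ∏ k ∈ s, sEntry (b k) (a k)) -
      (scalar (PowerSeries.C (μ : ℂ) + PowerSeries.X * (p : PowerSeries ℂ)) *
        PowerSeries.C (sEntry B A * ∏ k ∈ s, sEntry (b k) (a k)) +
      scalar PowerSeries.X * ∑ k ∈ s, PowerSeries.C
        (sEntry (b k) A * sEntry B (a k) * ∏ l ∈ s.erase k, sEntry (b l) (a l)))) := by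
  rw [inStarIdeal_iff]
  set H := ∏ k ∈ s, sEntry (b k) (a k) with hH
  have hHs : IsSmooth H := isSmooth_prod fun k _ => isSmooth_sEntry _ _
  have hHU (z : PhaseSpace p q) (U : Matrix.unitaryGroup (Fin p) ℂ) :
      H (z.act (unitaryToGL U)) = H z := by
    simp only [hH, Finset.prod_apply, sEntry_act_unitary]
  have hGs (i j : Fin p) : IsSmooth (rightInvEntry i A * leftInvEntry B j * H) :=
    ((isSmooth_rightInvEntry i A).mul (isSmooth_leftInvEntry B j)).mul hHs
  refine ⟨fun i j => PowerSeries.C (rightInvEntry i A * leftInvEntry B j * H),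
    fun n => ⟨fun i j => coeff_C_isSmooth (hGs i j) n, fun z U => ?_⟩, ?_⟩
  · simp only [PowerSeries.coeff_C]
    split_ifs
    · ext i j
      simp only [Matrix.of_apply, Pi.mul_apply, hHU, leftInvEntry_act_unitary,
        rightInvEntry_act_unitary, Matrix.mul_apply, Finset.sum_mul, Finset.mul_sum]
      exact Finset.sum_congr rfl fun k _ => Finset.sum_congr rfl fun l _ => by ring
    · have : (Matrix.of fun i j : Fin p => (0 : PhaseSpace p q → ℂ) z) = 0 := rfl
      rw [this, Matrix.mul_zero, Matrix.zero_mul]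
      rfl
  · simp only [eulerFormal_C, Finset.sum_add_distrib, ← Finset.mul_sum, ← map_sum, ← map_mul]
    have h1 : ∑ i, ∑ j, rightInvEntry i A * leftInvEntry B j * H * momentEntry μ j i =
        (tEntry B A - (μ : ℂ) • sEntry B A) * H := by
      rw [← sum_rightInv_mul_leftInv_mul_moment, Finset.sum_mul]
      refine Finset.sum_congr rfl fun i _ => ?_
      rw [Finset.sum_mul]
      exact Finset.sum_congr rfl fun j _ => by ring
    rw [h1, hH, sum_euler_rightInv_mul_leftInv, ← hH]
    have hX : scalar (PowerSeries.X : PowerSeries ℂ) = (PowerSeries.X : FormalFun p q) :=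
      PowerSeries.map_X _
    have hC (c : ℂ) : scalar (PowerSeries.C c) = (PowerSeries.C fun _ => c : FormalFun p q) :=
      PowerSeries.map_C _ _
    have hs (c : ℂ) (f : PhaseSpace p q → ℂ) :
        (PowerSeries.C (c • f) : FormalFun p q) = PowerSeries.C (fun _ => c) * PowerSeries.C f := by
      rw [← map_mul]; rfl
    have hp : (PowerSeries.C (fun _ => (p : ℂ)) : FormalFun p q) = (p : FormalFun p q) := by
      rw [← map_natCast PowerSeries.C]
      rfl
    simp only [map_add, map_mul, map_neg, map_sub, sub_mul, smul_mul_assoc, hs, hX, hC, hp,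
      map_natCast]
    ring

end GrassmannStar

end

/-! ### Cycle counts when a point is added to a permutation -/

noncomputable section

namespace GrassmannStar

open Equiv Equiv.Perm

/-! ### The number of cycles of a permutation -/

section Cycles

variable {α : Type*} [Fintype α] [DecidableEq α]

/-- The number of cycles of a permutation, fixed points included. -/
def cycleCount (σ : Perm α) : ℕ := Multiset.card σ.partition.parts

lemma cycleCount_add_card_support (σ : Perm α) :
    cycleCount σ + σ.support.card = Multiset.card σ.cycleType + Fintype.card α := by
  have := σ.support.card_le_univ
  rw [cycleCount, parts_partition, Multiset.card_add, Multiset.card_replicate]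
  omega

lemma two_mul_card_cycleType_le (σ : Perm α) :
    2 * Multiset.card σ.cycleType ≤ σ.support.card := by
  rw [← sum_cycleType, mul_comm, ← smul_eq_mul]
  exact Multiset.card_nsmul_le_sum fun n hn => two_le_of_mem_cycleType hn

lemma cycleCount_le (σ : Perm α) : cycleCount σ ≤ Fintype.card α := by
  have := cycleCount_add_card_support σ
  have := two_mul_card_cycleType_le σ
  omega

/-- A nontrivial cycle moves at least two points but counts once, so any nonempty cycle type makes
the count drop. This isolates the identity in the weight matrix modulo `λ`. -/
lemma eq_one_of_cycleCount_eq {σ : Perm α} (h : cycleCount σ = Fintype.card α) : σ = 1 := by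
  have := cycleCount_add_card_support σ
  have := two_mul_card_cycleType_le σ
  rw [← card_cycleType_eq_zero]
  omega

lemma cycleCount_one : cycleCount (1 : Perm α) = Fintype.card α := by
  have := cycleCount_add_card_support (1 : Perm α)
  simpa using this

/-- Write the cycle of `τ` through `b` as a list starting at `b`. Multiplication by `swap a b`
prepends the fixed point `a`, and the complementary factor `d` fixes both points and is untouched.
-/
lemma exists_cycle_factor {τ : Perm α} {a b : α} (ha : τ a = a) (hb : τ b ≠ b) :
    ∃ c c' d : Perm α, c.IsCycle ∧ c'.IsCycle ∧ c.Disjoint d ∧ c'.Disjoint d ∧ τ = c * d ∧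
      swap a b * τ = c' * d ∧ c'.support.card = c.support.card + 1 := by
  have hbs : b ∈ τ.support := mem_support.2 hb
  have hfac := cycleOf_mem_cycleFactorsFinset_iff.2 hbs
  set c := τ.cycleOf b with hc
  have hdis := disjoint_mul_inv_of_mem_cycleFactorsFinset hfac
  set d := τ * c⁻¹ with hd
  have hτ : τ = c * d := by rw [← hdis.commute.eq, hd, inv_mul_cancel_right]
  obtain ⟨l, hl⟩ : ∃ l, toList τ b = b :: l := by
    have hpos := length_toList_pos_of_mem_support τ b hbs
    obtain ⟨x, l, hxl⟩ := List.exists_cons_of_length_pos hpos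
    have h0 := toList_getElem_zero τ b hbs
    simp only [hxl, List.getElem_cons_zero] at h0
    exact ⟨l, by rw [hxl, h0]⟩
  have hlen : 2 ≤ (b :: l).length := by
    rw [← hl]; exact two_le_length_toList_iff_mem_support.2 hbs
  have hnd : (b :: l).Nodup := by rw [← hl]; exact nodup_toList τ b
  have hanot : a ∉ b :: l := by
    rw [← hl, mem_toList_iff]
    rintro ⟨hs, -⟩
    exact hb (hs.apply_eq_self_iff.2 ha)
  have hnd' : (a :: b :: l).Nodup := List.nodup_cons.2 ⟨hanot, hnd⟩
  have hcl : c = List.formPerm (b :: l) := by rw [← hl, formPerm_toList]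
  have hc'l : swap a b * c = List.formPerm (a :: b :: l) := by
    rw [List.formPerm_cons_cons, hcl]
  have hsc : c.support = (b :: l).toFinset := by
    rw [hcl]
    refine List.support_formPerm_of_nodup _ hnd fun x hx => ?_
    rw [hx] at hlen
    simp at hlen
  have hsc' : (swap a b * c).support = (a :: b :: l).toFinset := by
    rw [hc'l]
    refine List.support_formPerm_of_nodup _ hnd' fun x hx => ?_
    simp at hx
  refine ⟨c, swap a b * c, d, ?_, ?_, hdis.symm, ?_, hτ, by rw [hτ, mul_assoc], ?_⟩
  · rw [hcl]; exact List.isCycle_formPerm hnd hlen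
  · rw [hc'l]; exact List.isCycle_formPerm hnd' (by simp)
  · intro x
    by_cases hdx : d x = x
    · exact Or.inr hdx
    · left
      have hcx : c x = x := (hdis x).resolve_left hdx
      have hxb : x ≠ b := by
        rintro rfl
        exact hb (by rw [← cycleOf_apply_self, ← hc, hcx])
      have hxa : x ≠ a := by
        rintro rfl
        have hcx' : c⁻¹ x = x := by rw [inv_eq_iff_eq, hcx]
        exact hdx (by rw [hd, mul_apply, hcx', ha])
      rw [mul_apply, hcx, swap_apply_of_ne_of_ne hxa hxb]
  · rw [hsc, hsc', List.toFinset_card_of_nodup hnd, List.toFinset_card_of_nodup hnd',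
      List.length_cons]

/-- The fixed point `a` is absorbed into the cycle of `b`. If `b` is also fixed, two fixed points
merge into a transposition; otherwise an existing cycle gains one point. -/
lemma cycleCount_swap_mul {τ : Perm α} {a b : α} (hab : a ≠ b) (ha : τ a = a) :
    cycleCount (swap a b * τ) + 1 = cycleCount τ := by
  have h1 := cycleCount_add_card_support τ
  have h2 := cycleCount_add_card_support (swap a b * τ)
  by_cases hb : τ b = b
  · have hdis : (swap a b).Disjoint τ := by
      intro x
      by_cases hxa : x = a
      · exact Or.inr (hxa ▸ ha)
      by_cases hxb : x = b
      · exact Or.inr (hxb ▸ hb)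
      exact Or.inl (swap_apply_of_ne_of_ne hxa hxb)
    rw [hdis.cycleType_mul, hdis.card_support_mul, Multiset.card_add,
      (isCycle_swap hab).cycleType, Multiset.card_singleton, card_support_swap hab] at h2
    omega
  · obtain ⟨c, c', d, hc, hc', hcd, hc'd, hτ, hτ', hcard⟩ := exists_cycle_factor ha hb
    rw [hτ', hc'd.cycleType_mul, hc'd.card_support_mul, Multiset.card_add, hc'.cycleType,
      Multiset.card_singleton, hcard] at h2
    rw [hτ, hcd.cycleType_mul, hcd.card_support_mul, Multiset.card_add, hc.cycleType,
      Multiset.card_singleton] at h1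
    rw [hτ', hτ]
    omega

end Cycles

lemma decomposeFin_symm_zero_eq_extendDomain {n : ℕ} (σ : Perm (Fin n)) :
    decomposeFin.symm (0, σ) = σ.extendDomain (finSuccAboveEquiv (0 : Fin (n + 1))) := by
  ext1 x
  refine Fin.cases ?_ (fun k => ?_) x
  · rw [decomposeFin_symm_apply_zero, extendDomain_apply_not_subtype]
    simp
  · have h (m : Fin n) : ((finSuccAboveEquiv (0 : Fin (n + 1))) m : Fin (n + 1)) = m.succ := by
      simp [finSuccAboveEquiv_apply]
    rw [decomposeFin_symm_apply_succ, swap_self, refl_apply, ← h k, extendDomain_apply_image, h]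

lemma cycleCount_decomposeFin_symm_zero {n : ℕ} (σ : Perm (Fin n)) :
    cycleCount (decomposeFin.symm (0, σ)) = cycleCount σ + 1 := by
  have h1 := cycleCount_add_card_support σ
  have h2 := cycleCount_add_card_support (decomposeFin.symm (0, σ))
  rw [decomposeFin_symm_zero_eq_extendDomain, cycleType_extendDomain,
    card_support_extend_domain, ← decomposeFin_symm_zero_eq_extendDomain] at h2
  simp only [Nat.succ_eq_add_one, Fintype.card_fin] at h1 h2
  omega

lemma decomposeFin_symm_eq_swap_mul {n : ℕ} (j : Fin (n + 1)) (σ : Perm (Fin n)) :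
    decomposeFin.symm (j, σ) = swap 0 j * decomposeFin.symm (0, σ) := by
  ext1 x
  refine Fin.cases ?_ (fun k => ?_) x
  · simp
  · simp

lemma cycleCount_decomposeFin_symm_succ {n : ℕ} (m : Fin n) (σ : Perm (Fin n)) :
    cycleCount (decomposeFin.symm (m.succ, σ)) = cycleCount σ := by
  have h1 := cycleCount_swap_mul (τ := decomposeFin.symm (0, σ)) (Fin.succ_ne_zero m).symm
    (by simp)
  rw [← decomposeFin_symm_eq_swap_mul, cycleCount_decomposeFin_symm_zero] at h1
  omega

end GrassmannStar

end

/-! ### Tensor powers, existence of the decomposition, and the formula -/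

noncomputable section

namespace GrassmannStar

open Matrix Equiv Equiv.Perm
open scoped ComplexOrder

variable {p q : ℕ}

/-! ### The congruence for tensor powers -/

/-- `λ^(r - |σ|) (μ + λ p)^|σ|`. -/
def permWeight (μ : ℝ) (p : ℕ) {r : ℕ} (σ : Perm (Fin r)) : PowerSeries ℂ :=
  PowerSeries.X ^ (r - cycleCount σ) *
    (PowerSeries.C (μ : ℂ) + PowerSeries.X * (p : PowerSeries ℂ)) ^ cycleCount σ

lemma permWeight_decomposeFin_zero (μ : ℝ) (p : ℕ) {r : ℕ} (σ : Perm (Fin r)) :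
    permWeight μ p (decomposeFin.symm (0, σ)) =
      permWeight μ p σ * (PowerSeries.C (μ : ℂ) + PowerSeries.X * (p : PowerSeries ℂ)) := by
  rw [permWeight, permWeight, cycleCount_decomposeFin_symm_zero, Nat.succ_eq_add_one,
    Nat.add_sub_add_right, pow_succ]
  ring

lemma permWeight_decomposeFin_succ (μ : ℝ) (p : ℕ) {r : ℕ} (m : Fin r) (σ : Perm (Fin r)) :
    permWeight μ p (decomposeFin.symm (m.succ, σ)) = permWeight μ p σ * PowerSeries.X := by
  have := cycleCount_le σ
  rw [Fintype.card_fin] at this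
  rw [permWeight, permWeight, cycleCount_decomposeFin_symm_succ, Nat.succ_eq_add_one,
    Nat.sub_add_comm this, pow_succ]
  ring

/-- Sort the permutations of `r + 1` points by the image of `0`. Image `0` adds a cycle and
contributes `μ + λp`; image `m.succ` inserts `0` into the cycle of `m` and contributes `λ`. This is
the recursion matching the basic congruence. -/
lemma sum_permWeight_succ (μ : ℝ) {r : ℕ} (B A : Fin (r + 1) → Fin (p + q)) :
    ∑ σ : Perm (Fin (r + 1)),
      scalar (permWeight μ p σ) * PowerSeries.C (∏ k, sEntry (B k) (A (σ k))) =
    ∑ σ : Perm (Fin r), scalar (permWeight μ p σ) *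
      (scalar (PowerSeries.C (μ : ℂ) + PowerSeries.X * (p : PowerSeries ℂ)) *
        PowerSeries.C (sEntry (B 0) (A 0) * ∏ k : Fin r, sEntry (B k.succ) (A (σ k).succ)) +
      scalar PowerSeries.X * ∑ k : Fin r, PowerSeries.C
        (sEntry (B k.succ) (A 0) * sEntry (B 0) (A (σ k).succ) *
          ∏ l ∈ Finset.univ.erase k, sEntry (B l.succ) (A (σ l).succ))) := by
  rw [← Equiv.sum_comp (decomposeFin (n := r)).symm, Fintype.sum_prod_type, Finset.sum_comm]
  refine Finset.sum_congr rfl fun σ _ => ?_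
  rw [Fin.sum_univ_succ, permWeight_decomposeFin_zero, map_mul, mul_add, mul_assoc]
  refine congrArg₂ _ ?_ ?_
  · rw [Fin.prod_univ_succ]
    simp
  -- With the image of `0` written as `(σ k).succ`, it is `k.succ` that is now sent to `0`, so the
  -- factor `k` is the one exchanging its lower index with the new factor.
  · rw [← Equiv.sum_comp σ]
    simp only [Finset.mul_sum]
    refine Finset.sum_congr rfl fun k _ => ?_
    rw [permWeight_decomposeFin_succ, map_mul, mul_assoc, Fin.prod_univ_succ,
      ← Finset.mul_prod_erase Finset.univ _ (Finset.mem_univ k), decomposeFin_symm_apply_zero,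
      decomposeFin_symm_apply_succ, swap_apply_right]
    refine congrArg (fun f : FormalFun p q => _ * (_ * f)) (congrArg PowerSeries.C ?_)
    have h : ∏ l ∈ Finset.univ.erase k,
        sEntry (B l.succ) (A ((decomposeFin.symm ((σ k).succ, σ)) l.succ)) =
        ∏ l ∈ Finset.univ.erase k, sEntry (B l.succ) (A (σ l).succ) := by
      refine Finset.prod_congr rfl fun l hl => ?_
      rw [decomposeFin_symm_apply_succ, swap_apply_of_ne_of_ne (Fin.succ_ne_zero _)]
      intro h
      exact (Finset.mem_erase.1 hl).1 (σ.injective (Fin.succ_injective _ h))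
    rw [h]
    ring

/-- Multiply the congruence for the last `r` factors by the remaining entry of `T`, then convert
that entry next to each product of entries of `S` by the basic congruence. -/
lemma inStarIdeal_prod_tEntry_sub (μ : ℝ) {r : ℕ} (B A : Fin r → Fin (p + q)) :
    InStarIdeal μ (PowerSeries.C (∏ k, tEntry (B k) (A k)) -
      ∑ σ : Perm (Fin r),
        scalar (permWeight μ p σ) * PowerSeries.C (∏ k, sEntry (B k) (A (σ k)))) := by
  induction r with
  | zero =>
    have hc (σ : Perm (Fin 0)) : cycleCount σ = 0 := by
      have := cycleCount_le σ
      simpa using this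
    simp only [permWeight, hc, Finset.univ_eq_empty, Finset.prod_empty, Nat.sub_zero, pow_zero,
      map_one, mul_one, Finset.univ_unique, Finset.sum_const, Finset.card_singleton, one_smul,
      sub_self]
    exact inStarIdeal_zero μ
  | succ r ih =>
    have h1 := (ih (fun k => B k.succ) (fun k => A k.succ)).tEntry_mul (B 0) (A 0)
    have h2 := InStarIdeal.sum (s := Finset.univ) fun (σ : Perm (Fin r)) _ =>
      (inStarIdeal_tEntry_mul_prod_sub μ Finset.univ (fun k => B k.succ)
        (fun k => A (σ k).succ) (B 0) (A 0)).scalar_mul (permWeight μ p σ)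
    have h3 := h1.add h2
    rw [sum_permWeight_succ, Fin.prod_univ_succ]
    convert h3 using 1
    simp only [mul_sub, Finset.sum_sub_distrib, Finset.mul_sum, map_mul]
    rw [sub_add_sub_comm, sub_eq_sub_iff_add_eq_add]
    have : ∀ σ : Perm (Fin r), PowerSeries.C (tEntry (B 0) (A 0)) *
        (scalar (permWeight μ p σ) *
          (PowerSeries.C (∏ k : Fin r, sEntry (B k.succ) (A (σ k).succ)) : FormalFun p q)) =
        scalar (permWeight μ p σ) * (PowerSeries.C (tEntry (B 0) (A 0)) *
          PowerSeries.C (∏ k : Fin r, sEntry (B k.succ) (A (σ k).succ))) := fun σ => by ring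
    simp only [this]
    ring

/-! ### Inversion over formal power series -/

/-- The matrix `∑_σ λ^(r - |σ|) (μ + λ p)^|σ| ρ(σ)`. -/
def weightMatrix (μ : ℝ) (p q r : ℕ) :
    Matrix (Fin r → Fin (p + q)) (Fin r → Fin (p + q)) (PowerSeries ℂ) :=
  ∑ σ : Perm (Fin r), permWeight μ p σ • rhoPerm (PowerSeries ℂ) (p + q) σ

lemma constantCoeff_permWeight (μ : ℝ) (p : ℕ) {r : ℕ} (σ : Perm (Fin r)) :
    PowerSeries.constantCoeff (permWeight μ p σ) = if σ = 1 then (μ : ℂ) ^ r else 0 := by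
  have hle := cycleCount_le σ
  have h1 := fun h => eq_one_of_cycleCount_eq (σ := σ) h
  rw [Fintype.card_fin] at hle h1
  rw [permWeight]
  simp only [map_mul, map_pow, PowerSeries.constantCoeff_X, map_add, PowerSeries.constantCoeff_C,
    zero_mul, add_zero]
  split_ifs with h
  · have : cycleCount σ = r := by rw [h, cycleCount_one, Fintype.card_fin]
    rw [this, Nat.sub_self, pow_zero, one_mul]
  · have : r - cycleCount σ ≠ 0 := by
      intro h0
      exact h (h1 (by omega))
    rw [zero_pow this, zero_mul]

/-- Every `σ ≠ 1` carries a positive power of `λ`, so modulo `λ` the matrix is `μ^r` times the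
identity, and a power series is a unit as soon as its constant coefficient is. -/
lemma isUnit_det_weightMatrix {μ : ℝ} (hμ : 0 < μ) (p q r : ℕ) :
    IsUnit (weightMatrix μ p q r).det := by
  rw [PowerSeries.isUnit_iff_constantCoeff, RingHom.map_det]
  have : (PowerSeries.constantCoeff (R := ℂ)).mapMatrix (weightMatrix μ p q r) =
      ((μ : ℂ) ^ r) • 1 := by
    ext B A
    simp only [RingHom.mapMatrix_apply, Matrix.map_apply, weightMatrix, Matrix.sum_apply,
      Matrix.smul_apply, map_sum, smul_eq_mul, map_mul, constantCoeff_permWeight, ite_mul,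
      zero_mul, Finset.sum_ite_eq', Finset.mem_univ, if_true]
    refine congrArg _ ?_
    by_cases h : B = A
    · subst h; simp [rhoPerm]
    · simp [rhoPerm, h]
  rw [this, Matrix.det_smul, Matrix.det_one, mul_one]
  exact isUnit_iff_ne_zero.2 (pow_ne_zero _ (pow_ne_zero _ (by exact_mod_cast hμ.ne')))

lemma sum_rhoPerm_mul {K : Type*} [CommSemiring K] {s r : ℕ} {R : Type*} [CommSemiring R]
    (φ : K →+* R) (σ : Perm (Fin r)) (B : Fin r → Fin s) (X : (Fin r → Fin s) → R) :
    ∑ D, φ (rhoPerm K s σ B D) * X D = X (B ∘ σ.symm) := by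
  rw [Finset.sum_eq_single (B ∘ σ.symm)]
  · have : B = (B ∘ σ.symm) ∘ σ := by ext; simp
    simp [rhoPerm, ← this]
  · intro D _ hD
    have : B ≠ D ∘ σ := by
      rintro rfl
      exact hD (by ext; simp)
    simp [rhoPerm, this]
  · simp

lemma sTensor_apply (r : ℕ) (B A : Fin r → Fin (p + q)) :
    STensor p q r B A = PowerSeries.C (∏ k, sEntry (B k) (A k)) := by
  rw [STensor, Matrix.of_apply]
  refine congrArg _ (funext fun z => ?_)
  rw [Finset.prod_apply]
  rfl

lemma sum_weightMatrix_mul_sTensor (μ : ℝ) {r : ℕ} (B A : Fin r → Fin (p + q)) :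
    ∑ D, scalar (weightMatrix μ p q r B D) * STensor p q r D A =
      ∑ σ : Perm (Fin r),
        scalar (permWeight μ p σ) * PowerSeries.C (∏ k, sEntry (B k) (A (σ k))) := by
  simp only [weightMatrix, Matrix.sum_apply, Matrix.smul_apply, smul_eq_mul, map_sum, map_mul,
    Finset.sum_mul]
  rw [Finset.sum_comm]
  refine Finset.sum_congr rfl fun σ _ => ?_
  simp only [mul_assoc, ← Finset.mul_sum]
  -- Applying `ρ(σ)` on the left puts `σ⁻¹` on the upper indices; reindexing the product by `σ`
  -- moves it to the lower ones.
  rw [sum_rhoPerm_mul scalar σ B fun D => STensor p q r D A, sTensor_apply,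
    ← Equiv.prod_comp σ]
  simp

/-- The homogeneous part of `S^{⊗ r}`. -/
def homPartSTensor (μ : ℝ) (p q r : ℕ) :
    Matrix (Fin r → Fin (p + q)) (Fin r → Fin (p + q)) (FormalFun p q) :=
  fun B A => ∑ D, scalar ((weightMatrix μ p q r)⁻¹ B D) *
    PowerSeries.C (∏ k, tEntry (D k) (A k))

/-- The ideal is a module over `ℂ[[λ]]`, so the congruence between `T^{⊗r}` and the weight matrix
times `S^{⊗r}` can be inverted entry by entry. -/
lemma isHomPart_homPartSTensor {μ : ℝ} (hμ : 0 < μ) (r : ℕ) (B A : Fin r → Fin (p + q)) :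
    IsHomPart μ (STensor p q r B A) (homPartSTensor μ p q r B A) := by
  constructor
  · intro n
    simp only [homPartSTensor, map_sum, PowerSeries.coeff_mul_C]
    have hc (a : PowerSeries ℂ) : PowerSeries.coeff n (scalar a : FormalFun p q) =
        fun _ => PowerSeries.coeff n a := by
      rw [scalar, PowerSeries.coeff_map]; rfl
    simp only [hc]
    refine ⟨isSmooth_sum fun D _ =>
      (isSmooth_const _).mul (isSmooth_prod fun k _ => isSmooth_tEntry _ _), fun z g => ?_⟩
    simp only [Finset.sum_apply, Pi.mul_apply, Finset.prod_apply, tEntry_act]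
  · have hinv : (weightMatrix μ p q r)⁻¹ * weightMatrix μ p q r = 1 :=
      Matrix.nonsing_inv_mul _ (isUnit_det_weightMatrix hμ p q r)
    have h1 : STensor p q r B A = ∑ D, scalar ((weightMatrix μ p q r)⁻¹ B D) *
        ∑ E, scalar (weightMatrix μ p q r D E) * STensor p q r E A := by
      have : ∀ E, ∑ D, scalar ((weightMatrix μ p q r)⁻¹ B D) *
          (scalar (weightMatrix μ p q r D E) * STensor p q r E A) =
          scalar ((1 : Matrix (Fin r → Fin (p + q)) (Fin r → Fin (p + q)) (PowerSeries ℂ)) B E) *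
            STensor p q r E A := fun E => by
        rw [← hinv, Matrix.mul_apply, map_sum, Finset.sum_mul]
        exact Finset.sum_congr rfl fun D _ => by rw [map_mul, mul_assoc]
      simp only [Finset.mul_sum]
      rw [Finset.sum_comm]
      simp only [this]
      rw [Finset.sum_eq_single B]
      · simp
      · intro E _ hE
        simp [Matrix.one_apply_ne hE.symm]
      · simp
    rw [h1, homPartSTensor, ← Finset.sum_sub_distrib]
    refine InStarIdeal.sum fun D _ => ?_
    rw [← mul_sub, sum_weightMatrix_mul_sTensor]
    refine InStarIdeal.scalar_mul _ ?_
    -- The congruence has the opposite sign, hence the factor `−1`.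
    simpa using (inStarIdeal_prod_tEntry_sub μ D A).scalar_mul (-1)

lemma sum_weightMatrix_mul_homPart {μ : ℝ} (hμ : 0 < μ) (r : ℕ) (B A : Fin r → Fin (p + q)) :
    ∑ D, scalar (weightMatrix μ p q r B D) * homPartSTensor μ p q r D A =
      PowerSeries.C (∏ k, tEntry (B k) (A k)) := by
  have hinv : weightMatrix μ p q r * (weightMatrix μ p q r)⁻¹ = 1 :=
    Matrix.mul_nonsing_inv _ (isUnit_det_weightMatrix hμ p q r)
  have : ∀ E, ∑ D, scalar (weightMatrix μ p q r B D) *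
      (scalar ((weightMatrix μ p q r)⁻¹ D E) * PowerSeries.C (∏ k, tEntry (E k) (A k))) =
      scalar ((1 : Matrix (Fin r → Fin (p + q)) (Fin r → Fin (p + q)) (PowerSeries ℂ)) B E) *
        PowerSeries.C (∏ k, tEntry (E k) (A k)) := fun E => by
    rw [← hinv, Matrix.mul_apply, map_sum, Finset.sum_mul]
    exact Finset.sum_congr rfl fun D _ => by rw [map_mul, mul_assoc]
  simp only [homPartSTensor, Finset.mul_sum]
  rw [Finset.sum_comm]
  simp only [this]
  rw [Finset.sum_eq_single B]
  · simp
  · intro E _ hE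
    simp [Matrix.one_apply_ne hE.symm]
  · simp

/-! ### Passage to formal Laurent series -/

lemma lam_ne_zero : lam ≠ 0 := HahnSeries.single_ne_zero one_ne_zero

/-- Over Laurent series `μ + λp = λc`, so the powers of `λ` combine to `λ^r` independently of `σ`.
-/
lemma ofPowerSeries_permWeight (μ : ℝ) (p : ℕ) {r : ℕ} (σ : Perm (Fin r)) :
    HahnSeries.ofPowerSeries ℤ ℂ (permWeight μ p σ) =
      lam ^ r * cParam μ p ^ cycleCount σ := by
  have hle := cycleCount_le σ
  rw [Fintype.card_fin] at hle
  have hc : lam * cParam μ p = HahnSeries.C (μ : ℂ) + lam * (p : LaurentSeries ℂ) := by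
    rw [cParam, mul_add, ← mul_assoc, mul_inv_cancel₀ lam_ne_zero, one_mul]
  have hX : HahnSeries.ofPowerSeries ℤ ℂ PowerSeries.X = lam := HahnSeries.ofPowerSeries_X
  rw [permWeight, map_mul, map_pow, map_pow, map_add, map_mul, hX, HahnSeries.ofPowerSeries_C,
    map_natCast, ← hc, mul_pow, ← mul_assoc, ← pow_add, Nat.sub_add_cancel hle]

open Classical in
lemma rho_sum_classSum (K : Type*) [CommSemiring K] (s : ℕ) {r : ℕ} (c : K) :
    rho s (∑ α : ConjClasses (Perm (Fin r)), c ^ numCycles α • classSum K α) =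
      ∑ σ : Perm (Fin r), c ^ cycleCount σ • rhoPerm K s σ := by
  rw [rho]
  refine Finset.sum_congr rfl fun σ _ => congrArg (· • rhoPerm K s σ) ?_
  have hα (α : ConjClasses (Perm (Fin r))) : (classSum K α).coeff σ =
      if ConjClasses.mk σ = α then 1 else 0 := by
    rw [classSum, MonoidAlgebra.coeff_sum, Finsupp.finsetSum_apply]
    simp only [MonoidAlgebra.coeff_single, Finsupp.single_apply]
    rw [Finset.sum_ite_eq']
    simp
  rw [MonoidAlgebra.coeff_sum, Finsupp.finsetSum_apply, Finset.sum_eq_single (ConjClasses.mk σ)]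
  · rw [MonoidAlgebra.coeff_smul, Finsupp.smul_apply, hα, if_pos rfl, smul_eq_mul, mul_one]
    rfl
  · intro α _ hne
    rw [MonoidAlgebra.coeff_smul, Finsupp.smul_apply, hα, if_neg hne.symm, smul_zero]
  · simp

/-! ### The projector `T` -/

/-- The inverse square root of `x` is Hermitian and squares to `x⁻¹`, and the factors of `√μ` cancel
against `μ⁻¹`. -/
lemma tMat_eq {μ : ℝ} (hμ : 0 < μ) (z : PhaseSpace p q) :
    TMat μ z.1 = z.1 * (xMat z.1)⁻¹ * z.1ᴴ := by
  have hpos : 0 ≤ xMat z.1 :=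
    Matrix.nonneg_iff_posSemidef.2 (Matrix.posSemidef_conjTranspose_mul_self z.1)
  have hss : CFC.sqrt (xMat z.1) * CFC.sqrt (xMat z.1) = xMat z.1 :=
    CFC.sqrt_mul_sqrt_self _ hpos
  have hsa : (CFC.sqrt (xMat z.1))ᴴ = CFC.sqrt (xMat z.1) :=
    (Matrix.nonneg_iff_posSemidef.1 (CFC.sqrt_nonneg (xMat z.1))).isHermitian
  have hinv : (CFC.sqrt (xMat z.1))⁻¹ * (CFC.sqrt (xMat z.1))⁻¹ = (xMat z.1)⁻¹ := by
    rw [← Matrix.mul_inv_rev, hss]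
  have hsq : ((μ : ℂ)⁻¹) * ((Real.sqrt μ : ℝ) : ℂ) * ((Real.sqrt μ : ℝ) : ℂ) = 1 := by
    rw [mul_assoc, ← Complex.ofReal_mul, Real.mul_self_sqrt hμ.le]
    exact inv_mul_cancel₀ (by exact_mod_cast hμ.ne')
  rw [TMat, zeta, Matrix.conjTranspose_smul, Matrix.conjTranspose_mul,
    Matrix.conjTranspose_nonsing_inv, hsa, Matrix.smul_mul, Matrix.mul_smul, smul_smul, smul_smul]
  simp only [Complex.star_def, Complex.conj_ofReal]
  rw [hsq, one_smul, Matrix.mul_assoc, ← Matrix.mul_assoc _ _ z.1ᴴ, hinv, Matrix.mul_assoc]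

lemma tensorPow_tMat {μ : ℝ} (hμ : 0 < μ) (z : PhaseSpace p q) {r : ℕ}
    (B A : Fin r → Fin (p + q)) :
    tensorPow (TMat μ z.1) r B A = (∏ k, tEntry (B k) (A k)) z := by
  rw [tensorPow, Matrix.of_apply, Finset.prod_apply]
  simp only [tEntry, tMat_eq hμ z]

lemma smul_rho_mul_laurentAt {μ : ℝ} (hμ : 0 < μ) (r : ℕ) (z : PhaseSpace p q) :
    lam ^ r •
        (rho (p + q) (∑ α : ConjClasses (Perm (Fin r)),
            cParam μ p ^ numCycles α • classSum (LaurentSeries ℂ) α) *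
          laurentAt (homPartSTensor μ p q r) z) =
      (tensorPow (TMat μ z.1) r).map HahnSeries.C := by
  ext1 B A
  have hrho (D : Fin r → Fin (p + q)) :
      lam ^ r * rho (p + q) (∑ α : ConjClasses (Perm (Fin r)),
        cParam μ p ^ numCycles α • classSum (LaurentSeries ℂ) α) B D =
      HahnSeries.ofPowerSeries ℤ ℂ (weightMatrix μ p q r B D) := by
    rw [rho_sum_classSum]
    simp only [weightMatrix, Matrix.sum_apply, Matrix.smul_apply, map_sum,
      smul_eq_mul, map_mul, ofPowerSeries_permWeight, mul_assoc, Finset.mul_sum]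
    refine Finset.sum_congr rfl fun σ _ =>
      congrArg (fun t : LaurentSeries ℂ => lam ^ r * (cParam μ p ^ cycleCount σ * t)) ?_
    rw [rhoPerm, rhoPerm, Matrix.of_apply, Matrix.of_apply]
    split_ifs <;> simp
  refine (congrArg (lam ^ r * ·) (Matrix.mul_apply (M := rho (p + q) _))).trans ?_
  simp only [Finset.mul_sum, ← mul_assoc, hrho]
  rw [Matrix.map_apply, tensorPow_tMat hμ]
  have h := congrArg (fun F => HahnSeries.ofPowerSeries ℤ ℂ (evalAt z F))
    (sum_weightMatrix_mul_homPart hμ r B A)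
  have hs (a : PowerSeries ℂ) : evalAt z (scalar a : FormalFun p q) = a := by
    ext n
    rw [evalAt, scalar, PowerSeries.coeff_map, PowerSeries.coeff_map]
    rfl
  simp only [map_sum, map_mul, hs] at h
  refine h.trans ?_
  rw [evalAt, PowerSeries.map_C, HahnSeries.ofPowerSeries_C]
  rfl

lemma IsHomPart.eq_of_forall {μ : ℝ}
    (huniq : ∀ f : FormalFun p q, IsHomogeneous f → InStarIdeal μ f → f = 0)
    {F f f' : FormalFun p q} (hf : IsHomPart μ F f) (hf' : IsHomPart μ F f') : f = f' := by
  refine sub_eq_zero.1 (huniq _ (fun n => ⟨?_, fun z g => ?_⟩) ?_)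
  · have h := ((hf'.1 n).1.const_smul (-1)).add (hf.1 n).1
    rw [map_sub, sub_eq_neg_add]
    simpa using h
  · rw [map_sub, Pi.sub_apply, Pi.sub_apply, (hf.1 n).2, (hf'.1 n).2]
  · have h := hf'.2.sub hf.2
    rwa [sub_sub_sub_cancel_left] at h

/-- `proj` is a choice of homogeneous part; once zero is the only homogeneous element of the ideal,
any homogeneous part is the chosen one. -/
lemma proj_eq {μ : ℝ}
    (huniq : ∀ f : FormalFun p q, IsHomogeneous f → InStarIdeal μ f → f = 0)
    {F f : FormalFun p q} (hf : IsHomPart μ F f) : proj μ F = f := by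
  have h : ∃ f, IsHomPart μ F f := ⟨f, hf⟩
  rw [proj, dif_pos h]
  exact h.choose_spec.eq_of_forall huniq hf

end GrassmannStar

end

/-! ### The weight function on a GL(p) orbit -/

noncomputable section

namespace GrassmannStar

open Matrix Topology Filter
open scoped ComplexOrder

variable {p q m : ℕ}

/-! ### Holomorphic derivatives of composite functions -/

section Composition

variable {E E' : Type*} [NormedAddCommGroup E] [NormedSpace ℝ E] [NormedSpace ℂ E]
  [IsScalarTower ℝ ℂ E] [NormedAddCommGroup E'] [NormedSpace ℝ E'] [NormedSpace ℂ E']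
  [IsScalarTower ℝ ℂ E']

lemma holDeriv_comp_clm (ℓ : E →L[ℂ] E') {F : E' → ℂ} {w : E} (hF : DifferentiableAt ℝ F (ℓ w))
    (v : E) : holDeriv (fun g => F (ℓ g)) w v = holDeriv F (ℓ w) (ℓ v) := by
  have h : HasFDerivAt (fun g => F (ℓ g)) ((fderiv ℝ F (ℓ w)).comp (ℓ.restrictScalars ℝ)) w :=
    hF.hasFDerivAt.comp w (ℓ.restrictScalars ℝ).hasFDerivAt
  simp only [holDeriv, h.fderiv, ContinuousLinearMap.comp_apply,
    ContinuousLinearMap.coe_restrictScalars', map_smul]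

set_option linter.unusedSectionVars false in
lemma holDeriv_comp_real {h : ℝ → ℝ} {ψ : E → ℝ} {w : E} (hh : DifferentiableAt ℝ h (ψ w))
    (hψ : DifferentiableAt ℝ ψ w) (v : E) :
    holDeriv (fun g => ((h (ψ g) : ℝ) : ℂ)) w v =
      ((deriv h (ψ w) : ℝ) : ℂ) * holDeriv (fun g => ((ψ g : ℝ) : ℂ)) w v := by
  have h1 : HasFDerivAt (fun g => ((ψ g : ℝ) : ℂ)) (Complex.ofRealCLM.comp (fderiv ℝ ψ w)) w :=
    Complex.ofRealCLM.hasFDerivAt.comp w hψ.hasFDerivAt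
  have h2 : HasFDerivAt (fun g => ((h (ψ g) : ℝ) : ℂ))
      (Complex.ofRealCLM.comp (deriv h (ψ w) • fderiv ℝ ψ w)) w :=
    Complex.ofRealCLM.hasFDerivAt.comp w (hh.hasDerivAt.comp_hasFDerivAt w hψ.hasFDerivAt)
  simp only [holDeriv, h1.fderiv, h2.fderiv, ContinuousLinearMap.comp_apply,
    _root_.smul_apply, Complex.ofRealCLM_apply, smul_eq_mul, Complex.ofReal_mul]
  ring

set_option linter.unusedSectionVars false in
lemma holDeriv_of_fderiv {F : E → ℂ} {w v : E} {a b : ℂ} (ha : fderiv ℝ F w v = a)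
    (hb : fderiv ℝ F w (Complex.I • v) = b) :
    holDeriv F w v = (1 / 2 : ℂ) * (a - Complex.I * b) := by
  rw [holDeriv, ha, hb]

set_option linter.unusedSectionVars false in
lemma holDeriv_star_eq_zero {F : E → ℂ} {w v : E} {a : ℂ} (hF : DifferentiableAt ℝ F w)
    (ha : fderiv ℝ F w v = a) (hb : fderiv ℝ F w (Complex.I • v) = Complex.I * a) :
    holDeriv (fun g => star (F g)) w v = 0 := by
  have h : HasFDerivAt (fun g => star (F g)) ((Complex.conjCLE : ℂ →L[ℝ] ℂ).comp (fderiv ℝ F w)) w :=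
    (Complex.conjCLE : ℂ →L[ℝ] ℂ).hasFDerivAt.comp w hF.hasFDerivAt
  rw [holDeriv, h.fderiv, ContinuousLinearMap.comp_apply, ContinuousLinearMap.comp_apply, ha, hb]
  simp only [ContinuousLinearEquiv.coe_coe, Complex.conjCLE_apply, map_mul, Complex.conj_I]
  linear_combination (1 / 2 * (starRingEnd ℂ) a) * Complex.I_mul_I

set_option linter.unusedSectionVars false in
lemma holDeriv_eq_zero_of_isLocalMax {ψ : E → ℝ} {w : E} (hψ : DifferentiableAt ℝ ψ w)
    (hmax : IsLocalMax ψ w) (v : E) : holDeriv (fun g => ((ψ g : ℝ) : ℂ)) w v = 0 := by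
  have h1 : HasFDerivAt (fun g => ((ψ g : ℝ) : ℂ)) (Complex.ofRealCLM.comp (fderiv ℝ ψ w)) w :=
    Complex.ofRealCLM.hasFDerivAt.comp w hψ.hasFDerivAt
  simp [holDeriv, h1.fderiv, hmax.fderiv_eq_zero]

end Composition

/-- Left multiplication by a matrix. -/
def leftMulCLM (z : Matrix (Fin m) (Fin p) ℂ) :
    Matrix (Fin p) (Fin p) ℂ →L[ℂ] Matrix (Fin m) (Fin p) ℂ :=
  LinearMap.toContinuousLinearMap
    { toFun := fun g => z * g
      map_add' := Matrix.mul_add z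
      map_smul' := fun c g => Matrix.mul_smul z c g }

/-! ### The determinant -/

lemma contDiff_det_id : ContDiff ℝ ∞ fun g : Matrix (Fin p) (Fin p) ℂ => g.det :=
  contDiff_det contDiff_matrix_apply

/-- Jacobi's formula, from `det (g + t gX) = det g · det (1 + tX)` and the expansion of the last
determinant as `1 + t tr X` plus `t²` times a polynomial in `t`. -/
lemma fderiv_det (g X : Matrix (Fin p) (Fin p) ℂ) :
    fderiv ℝ (fun g : Matrix (Fin p) (Fin p) ℂ => g.det) g (g * X) = g.det * X.trace := by
  have h1 : HasFDerivAt (fun g : Matrix (Fin p) (Fin p) ℂ => g.det)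
      (fderiv ℝ (fun g : Matrix (Fin p) (Fin p) ℂ => g.det) g) (g + (0 : ℝ) • (g * X)) := by
    rw [zero_smul, add_zero]
    exact (contDiff_det_id.differentiable (by simp) g).hasFDerivAt
  have h2 : HasDerivAt (fun t : ℝ => g + t • (g * X)) (g * X) 0 := by
    have h := (hasDerivAt_id (0 : ℝ)).smul_const (g * X)
    rw [one_smul] at h
    exact h.const_add g
  have h3 := h1.comp_hasDerivAt (0 : ℝ) h2
  have h4 : HasDerivAt (fun t : ℝ => (t : ℂ)) 1 0 := Complex.ofRealCLM.hasDerivAt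
  have h5 : HasDerivAt (fun t : ℝ => g.det * (1 + X.trace * (t : ℂ) +
      (det (1 + (Polynomial.X : Polynomial ℂ) • X.map Polynomial.C)).divX.divX.eval (t : ℂ) *
        (t : ℂ) ^ 2)) (g.det * X.trace) 0 := by
    set P := (det (1 + (Polynomial.X : Polynomial ℂ) • X.map Polynomial.C)).divX.divX
    have hP : HasDerivAt (fun t : ℝ => P.eval (t : ℂ)) (P.derivative.eval ((0 : ℝ) : ℂ)) 0 :=
      (P.hasDerivAt ((0 : ℝ) : ℂ)).comp_ofReal
    have := (((h4.const_mul X.trace).const_add 1).add (hP.mul (h4.pow 2))).const_mul g.det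
    simpa using this
  refine h3.unique (h5.congr_of_eventuallyEq (Eventually.of_forall fun t => ?_))
  have : g + t • (g * X) = g * (1 + (t : ℂ) • X) := by
    rw [Matrix.mul_add, Matrix.mul_one, Matrix.mul_smul]
    rfl
  rw [Function.comp_apply, this, Matrix.det_mul, Matrix.det_one_add_smul]

lemma holDeriv_det (g X : Matrix (Fin p) (Fin p) ℂ) :
    holDeriv (fun g : Matrix (Fin p) (Fin p) ℂ => g.det) g (g * X) = g.det * X.trace := by
  refine (holDeriv_of_fderiv (fderiv_det g X) (b := Complex.I * (g.det * X.trace)) ?_).trans ?_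
  · rw [← Matrix.mul_smul]
    refine (fderiv_det g _).trans ?_
    rw [Matrix.trace_smul, smul_eq_mul]
    ring
  linear_combination (-(1 / 2) * g.det * X.trace) * Complex.I_mul_I

lemma holDeriv_conj_det (g X : Matrix (Fin p) (Fin p) ℂ) :
    holDeriv (fun g : Matrix (Fin p) (Fin p) ℂ => star g.det) g (g * X) = 0 := by
  refine holDeriv_star_eq_zero (contDiff_det_id.differentiable (by simp) g) (fderiv_det g X) ?_
  rw [← Matrix.mul_smul]
  refine (fderiv_det g _).trans ?_
  rw [Matrix.trace_smul, smul_eq_mul]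
  ring

/-! ### The weight function on the orbit of a point -/

/-- The matrix `x` at the point `z g` of the orbit of `z`. -/
def orbitMat (z : Matrix (Fin m) (Fin p) ℂ) (g : Matrix (Fin p) (Fin p) ℂ) :
    Matrix (Fin p) (Fin p) ℂ := (z * g)ᴴ * (z * g)

/-- The trace of `x` at the point `z g`. -/
def orbitTrace (z : Matrix (Fin m) (Fin p) ℂ) (g : Matrix (Fin p) (Fin p) ℂ) : ℝ :=
  ∑ k, (orbitMat z g k k).re

/-- The weight `|det g|² exp (- tr x / μ)`. -/
def orbitWeight (μ : ℝ) (z : Matrix (Fin m) (Fin p) ℂ) (g : Matrix (Fin p) (Fin p) ℂ) : ℝ :=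
  Complex.normSq g.det * Real.exp (-(1 / μ) * orbitTrace z g)

lemma contDiff_orbitMat (z : Matrix (Fin m) (Fin p) ℂ) (i j : Fin p) :
    ContDiff ℝ ∞ fun g => orbitMat z g i j :=
  (contDiff_xMat i j).comp ((leftMulCLM z).restrictScalars ℝ).contDiff

lemma holDeriv_orbitMat (z : Matrix (Fin m) (Fin p) ℂ) (i j : Fin p)
    (g X : Matrix (Fin p) (Fin p) ℂ) :
    holDeriv (fun g => orbitMat z g i j) g (g * X) = (orbitMat z g * X) i j := by
  refine (holDeriv_comp_clm (leftMulCLM z)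
    ((contDiff_xMat (m := m) i j).differentiable (by simp) _) _).trans ?_
  rw [holDeriv_conjTranspose_mul]
  change ((z * g)ᴴ * (z * (g * X))) i j = _
  rw [orbitMat, ← Matrix.mul_assoc z, ← Matrix.mul_assoc]

lemma orbitMat_diag_eq (z : Matrix (Fin m) (Fin p) ℂ) (g : Matrix (Fin p) (Fin p) ℂ) (k : Fin p) :
    orbitMat z g k k = ((∑ A, Complex.normSq ((z * g) A k) : ℝ) : ℂ) := by
  rw [orbitMat, Matrix.mul_apply, Complex.ofReal_sum]
  refine Finset.sum_congr rfl fun A _ => ?_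
  rw [Matrix.conjTranspose_apply, Complex.normSq_eq_conj_mul_self]
  rfl

lemma ofReal_orbitTrace (z : Matrix (Fin m) (Fin p) ℂ) (g : Matrix (Fin p) (Fin p) ℂ) :
    (orbitTrace z g : ℂ) = ∑ k, orbitMat z g k k := by
  rw [orbitTrace, Complex.ofReal_sum]
  refine Finset.sum_congr rfl fun k _ => ?_
  rw [orbitMat_diag_eq, Complex.ofReal_re]

lemma contDiff_orbitTrace (z : Matrix (Fin m) (Fin p) ℂ) : ContDiff ℝ ∞ (orbitTrace z) :=
  ContDiff.sum fun k _ => Complex.reCLM.contDiff.comp (contDiff_orbitMat z k k)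

lemma contDiff_orbitWeight (μ : ℝ) (z : Matrix (Fin m) (Fin p) ℂ) :
    ContDiff ℝ ∞ (orbitWeight μ z) := by
  refine ContDiff.mul ?_ (Real.contDiff_exp.comp (contDiff_const.mul (contDiff_orbitTrace z)))
  simp only [Complex.normSq_apply]
  have hr : ContDiff ℝ ∞ fun g : Matrix (Fin p) (Fin p) ℂ => g.det.re :=
    Complex.reCLM.contDiff.comp contDiff_det_id
  have hi : ContDiff ℝ ∞ fun g : Matrix (Fin p) (Fin p) ℂ => g.det.im :=
    Complex.imCLM.contDiff.comp contDiff_det_id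
  exact (hr.mul hr).add (hi.mul hi)

lemma holDeriv_orbitTrace (z : Matrix (Fin m) (Fin p) ℂ) (g X : Matrix (Fin p) (Fin p) ℂ) :
    holDeriv (fun g => (orbitTrace z g : ℂ)) g (g * X) = (orbitMat z g * X).trace := by
  simp only [ofReal_orbitTrace]
  rw [holDeriv_sum fun k _ => (contDiff_orbitMat z k k).differentiable (by simp) g]
  simp only [holDeriv_orbitMat]
  rfl

lemma holDeriv_exp_orbitTrace (c : ℝ) (z : Matrix (Fin m) (Fin p) ℂ)
    (g X : Matrix (Fin p) (Fin p) ℂ) :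
    holDeriv (fun g => ((Real.exp (-c * orbitTrace z g) : ℝ) : ℂ)) g (g * X) =
      -(c : ℂ) * (Real.exp (-c * orbitTrace z g) : ℂ) * (orbitMat z g * X).trace := by
  have hd : HasDerivAt (fun s : ℝ => Real.exp (-c * s))
      (Real.exp (-c * orbitTrace z g) * (-c)) (orbitTrace z g) := by
    simpa using ((hasDerivAt_id (orbitTrace z g)).const_mul (-c)).exp
  rw [holDeriv_comp_real (h := fun s => Real.exp (-c * s)) (ψ := orbitTrace z)
    hd.differentiableAt ((contDiff_orbitTrace z).differentiable (by simp) g), hd.deriv,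
    holDeriv_orbitTrace]
  push_cast
  ring

/-- Where `det g ≠ 0`, the weight is `det g` times its conjugate times an exponential, and its
holomorphic logarithmic derivative along `gX` is `tr X − tr(xX)/μ`. For `X = e_{ij}` this is `−(x −
μ)_{ji}/μ`: the weight is chosen so that `x − μ` appears as a derivative. -/
lemma holDeriv_orbitWeight (μ : ℝ) (z : Matrix (Fin m) (Fin p) ℂ)
    (g X : Matrix (Fin p) (Fin p) ℂ) :
    holDeriv (fun g => (orbitWeight μ z g : ℂ)) g (g * X) =
      orbitWeight μ z g * (X.trace - 1 / μ * (orbitMat z g * X).trace) := by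
  have hw : (fun g => (orbitWeight μ z g : ℂ)) =
      ((fun g : Matrix (Fin p) (Fin p) ℂ => star g.det) * fun g => g.det) *
        fun g => ((Real.exp (-(1 / μ) * orbitTrace z g) : ℝ) : ℂ) := by
    ext g
    rw [orbitWeight, Complex.ofReal_mul, Complex.normSq_eq_conj_mul_self]
    rfl
  have h1 : DifferentiableAt ℝ (fun g : Matrix (Fin p) (Fin p) ℂ => g.det) g :=
    contDiff_det_id.differentiable (by simp) g
  have h2 : DifferentiableAt ℝ (fun g : Matrix (Fin p) (Fin p) ℂ => star g.det) g :=
    (Complex.conjCLE : ℂ →L[ℝ] ℂ).differentiableAt.comp g h1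
  have h3 : DifferentiableAt ℝ (fun g => ((Real.exp (-(1 / μ) * orbitTrace z g) : ℝ) : ℂ)) g :=
    Complex.ofRealCLM.differentiableAt.comp g
      (((contDiff_orbitTrace z).differentiable (by simp) g).const_mul _).exp
  rw [hw, holDeriv_mul (h2.mul h1) h3, holDeriv_mul h2 h1, holDeriv_det, holDeriv_conj_det,
    holDeriv_exp_orbitTrace, orbitWeight, Complex.ofReal_mul, Complex.normSq_eq_conj_mul_self]
  simp only [Pi.mul_apply, Complex.star_def]
  push_cast
  ring

/-! ### Superlevel sets of the weight function -/

lemma orbitWeight_pos_iff (μ : ℝ) (z : Matrix (Fin m) (Fin p) ℂ) (g : Matrix (Fin p) (Fin p) ℂ) :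
    0 < orbitWeight μ z g ↔ g.det ≠ 0 := by
  rw [orbitWeight, mul_pos_iff_of_pos_right (Real.exp_pos _), Complex.normSq_pos]

lemma orbitTrace_nonneg (z : Matrix (Fin m) (Fin p) ℂ) (g : Matrix (Fin p) (Fin p) ℂ) :
    0 ≤ orbitTrace z g := by
  refine Finset.sum_nonneg fun k _ => ?_
  rw [orbitMat_diag_eq, Complex.ofReal_re]
  exact Finset.sum_nonneg fun A _ => Complex.normSq_nonneg _

lemma norm_mul_apply_le (z : Matrix (Fin m) (Fin p) ℂ) (g : Matrix (Fin p) (Fin p) ℂ)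
    (A : Fin m) (k : Fin p) : ‖(z * g) A k‖ ≤ √(orbitTrace z g) := by
  refine Real.le_sqrt_of_sq_le ?_
  rw [← Complex.normSq_eq_norm_sq, orbitTrace]
  have h1 : Complex.normSq ((z * g) A k) ≤ (orbitMat z g k k).re := by
    rw [orbitMat_diag_eq, Complex.ofReal_re]
    exact Finset.single_le_sum (f := fun A => Complex.normSq ((z * g) A k))
      (fun A _ => Complex.normSq_nonneg _) (Finset.mem_univ A)
  refine h1.trans (Finset.single_le_sum (f := fun k => (orbitMat z g k k).re) (fun k _ => ?_)
    (Finset.mem_univ k))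
  rw [orbitMat_diag_eq, Complex.ofReal_re]
  exact Finset.sum_nonneg fun A _ => Complex.normSq_nonneg _

/-- `z` has the left inverse `x⁻¹z†`, so `g` is recovered linearly from `zg`, whose entries are
bounded by the square root of `tr x`. -/
lemma exists_norm_le_sqrt_orbitTrace (z : PhaseSpace p q) :
    ∃ C : ℝ, 0 ≤ C ∧ ∀ (g : Matrix (Fin p) (Fin p) ℂ), ‖g‖ ≤ C * √(orbitTrace z.1 g) := by
  refine ⟨∑ i, ∑ A, ‖((xMat z.1)⁻¹ * z.1ᴴ) i A‖,
    Finset.sum_nonneg fun i _ => Finset.sum_nonneg fun A _ => norm_nonneg _, fun g => ?_⟩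
  have hg : g = ((xMat z.1)⁻¹ * z.1ᴴ) * (z.1 * g) := by
    rw [Matrix.mul_assoc, ← Matrix.mul_assoc z.1ᴴ]
    change g = (xMat z.1)⁻¹ * (xMat z.1 * g)
    rw [← Matrix.mul_assoc, xMat_inv_mul, Matrix.one_mul]
  refine (Matrix.norm_le_iff (mul_nonneg (Finset.sum_nonneg fun i _ =>
    Finset.sum_nonneg fun A _ => norm_nonneg _) (Real.sqrt_nonneg _))).2 fun i k => ?_
  conv_lhs => rw [hg, Matrix.mul_apply]
  refine (norm_sum_le _ _).trans ?_
  have h1 : ∑ A, ‖((xMat z.1)⁻¹ * z.1ᴴ) i A * (z.1 * g) A k‖ ≤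
      (∑ A, ‖((xMat z.1)⁻¹ * z.1ᴴ) i A‖) * √(orbitTrace z.1 g) := by
    rw [Finset.sum_mul]
    refine Finset.sum_le_sum fun A _ => ?_
    rw [norm_mul]
    exact mul_le_mul_of_nonneg_left (norm_mul_apply_le z.1 g A k) (norm_nonneg _)
  refine h1.trans (mul_le_mul_of_nonneg_right ?_ (Real.sqrt_nonneg _))
  exact Finset.single_le_sum (f := fun i => ∑ A, ‖((xMat z.1)⁻¹ * z.1ᴴ) i A‖)
    (fun i _ => Finset.sum_nonneg fun A _ => norm_nonneg _) (Finset.mem_univ i)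

lemma norm_det_le (g : Matrix (Fin p) (Fin p) ℂ) : ‖g.det‖ ≤ p.factorial * ‖g‖ ^ p := by
  have h := Matrix.det_le (A := g) (abv := NormedField.toAbsoluteValue ℂ) (x := ‖g‖)
    fun i j => Matrix.norm_entry_le_entrywise_sup_norm g
  simpa [Fintype.card_fin] using! h

/-- With `t = tr x` at `zg`, one has `‖g‖ ≤ C √t` and so `|det g|² ≤ (p! C^p)² t^p`. The weight is
thus at most a constant times `t^p e^{−t/μ}`, which falls below `δ` for large `t`; hence `t`, and
with it `g`, is bounded. -/
lemma isBounded_superlevel {μ : ℝ} (hμ : 0 < μ) (z : PhaseSpace p q) {δ : ℝ} (hδ : 0 < δ) :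
    Bornology.IsBounded {g | δ ≤ orbitWeight μ z.1 g} := by
  obtain ⟨C, hC, hgC⟩ := exists_norm_le_sqrt_orbitTrace z
  have hlim : Tendsto (fun t : ℝ => (p.factorial * C ^ p) ^ 2 * μ ^ p *
      ((t / μ) ^ p * Real.exp (-(t / μ)))) atTop (𝓝 0) := by
    have := ((Real.tendsto_pow_mul_exp_neg_atTop_nhds_zero p).comp
      (tendsto_id.atTop_div_const hμ)).const_mul ((p.factorial * C ^ p : ℝ) ^ 2 * μ ^ p)
    simpa using this
  obtain ⟨R, hR⟩ := eventually_atTop.1 (hlim.eventually (gt_mem_nhds hδ))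
  refine (Metric.isBounded_closedBall (x := 0) (r := C * √R)).subset fun g hg => ?_
  rw [mem_closedBall_zero_iff]
  have ht := orbitTrace_nonneg z.1 g
  have htR : orbitTrace z.1 g ≤ R := by
    by_contra! hlt
    refine absurd (hR _ hlt.le) (not_lt.2 (le_trans hg ?_))
    have h1 : ‖g.det‖ ≤ p.factorial * C ^ p * √(orbitTrace z.1 g) ^ p := by
      refine (norm_det_le g).trans ?_
      rw [mul_assoc, ← mul_pow]
      gcongr
      exact hgC g
    have h2 : Complex.normSq g.det ≤ (p.factorial * C ^ p) ^ 2 * orbitTrace z.1 g ^ p := by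
      rw [Complex.normSq_eq_norm_sq]
      refine (pow_le_pow_left₀ (norm_nonneg _) h1 2).trans (le_of_eq ?_)
      rw [mul_pow, ← pow_mul, mul_comm p 2, pow_mul, Real.sq_sqrt ht]
    have h3 : μ ^ p * (orbitTrace z.1 g / μ) ^ p = orbitTrace z.1 g ^ p := by
      rw [← mul_pow, mul_div_cancel₀ _ hμ.ne']
    calc orbitWeight μ z.1 g ≤ (p.factorial * C ^ p) ^ 2 * orbitTrace z.1 g ^ p *
          Real.exp (-(1 / μ) * orbitTrace z.1 g) :=
          mul_le_mul_of_nonneg_right h2 (Real.exp_pos _).le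
      _ = _ := by
          rw [← h3, show -(1 / μ) * orbitTrace z.1 g = -(orbitTrace z.1 g / μ) by ring]
          ring
  exact (hgC g).trans (mul_le_mul_of_nonneg_left (Real.sqrt_le_sqrt htR) hC)

lemma isCompact_superlevel {μ : ℝ} (hμ : 0 < μ) (z : PhaseSpace p q) {δ : ℝ} (hδ : 0 < δ) :
    IsCompact {g | δ ≤ orbitWeight μ z.1 g} :=
  Metric.isCompact_of_isClosed_isBounded
    (isClosed_le continuous_const (contDiff_orbitWeight μ z.1).continuous)
    (isBounded_superlevel hμ z hδ)

lemma exists_max_orbitWeight {μ : ℝ} (hμ : 0 < μ) (z : PhaseSpace p q) :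
    ∃ g₀, 0 < orbitWeight μ z.1 g₀ ∧ ∀ g, orbitWeight μ z.1 g ≤ orbitWeight μ z.1 g₀ := by
  have h1 : 0 < orbitWeight μ z.1 1 := by
    rw [orbitWeight_pos_iff, Matrix.det_one]
    exact one_ne_zero
  obtain ⟨g₀, hg₀, hmax⟩ := (isCompact_superlevel hμ z h1).exists_isMaxOn
    ⟨1, le_refl (orbitWeight μ z.1 1)⟩
    (contDiff_orbitWeight μ z.1).continuous.continuousOn
  refine ⟨g₀, h1.trans_le hg₀, fun g => ?_⟩
  by_cases hg : orbitWeight μ z.1 1 ≤ orbitWeight μ z.1 g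
  · exact hmax hg
  · exact (not_le.1 hg).le.trans hg₀

/-- At a maximum the logarithmic derivative along each `g e_{ij}` vanishes, which reads `x = μ`
entry by entry. -/
lemma orbitMat_eq_of_max {μ : ℝ} (hμ : 0 < μ) (z : Matrix (Fin m) (Fin p) ℂ)
    {g : Matrix (Fin p) (Fin p) ℂ} (hpos : 0 < orbitWeight μ z g)
    (hmax : ∀ g', orbitWeight μ z g' ≤ orbitWeight μ z g) (j i : Fin p) :
    (orbitMat z g - (μ : ℂ) • (1 : Matrix (Fin p) (Fin p) ℂ)) j i = 0 := by
  have h1 := (holDeriv_orbitWeight μ z g (Matrix.single i j 1)).symm.trans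
    (holDeriv_eq_zero_of_isLocalMax ((contDiff_orbitWeight μ z).differentiable (by simp) g)
      (Eventually.of_forall hmax) _)
  have h2 := (mul_eq_zero.1 h1).resolve_left (by exact_mod_cast hpos.ne')
  have hμ' : (μ : ℂ) ≠ 0 := by exact_mod_cast hμ.ne'
  rw [Matrix.trace_mul_single] at h2
  rw [Matrix.sub_apply, Matrix.smul_apply, smul_eq_mul]
  by_cases hij : j = i
  · subst hij
    rw [Matrix.trace_single_eq_same] at h2
    rw [Matrix.one_apply_eq]
    field_simp at h2
    simp only [MulOpposite.smul_eq_mul_unop, MulOpposite.unop_op] at h2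
    linear_combination -h2
  · rw [Matrix.trace_single_eq_of_ne _ _ _ (Ne.symm hij)] at h2
    rw [Matrix.one_apply_ne hij]
    field_simp at h2
    simp only [MulOpposite.smul_eq_mul_unop, MulOpposite.unop_op] at h2
    linear_combination -h2

end GrassmannStar

end

/-! ### Integration by parts against functions of the weight -/

noncomputable section

namespace GrassmannStar

open Matrix Topology Filter MeasureTheory
open scoped ComplexOrder

variable {p q m : ℕ}

/-! ### Integration by parts -/

section Integration

variable {E : Type*} [NormedAddCommGroup E] [NormedSpace ℝ E] [NormedSpace ℂ E]
  [FiniteDimensional ℝ E] [MeasurableSpace E] [BorelSpace E] (ν : Measure E)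
  [ν.IsAddHaarMeasure] {Φ : E → ℂ}

omit [NormedSpace ℂ E] in
lemma integral_fderiv_eq_zero (hΦ : ContDiff ℝ 1 Φ) (hc : HasCompactSupport Φ) (v : E) :
    ∫ g, fderiv ℝ Φ g v ∂ν = 0 := by
  have hi : Integrable (fun g => fderiv ℝ Φ g v) ν :=
    ((hΦ.continuous_fderiv one_ne_zero).clm_apply continuous_const).integrable_of_hasCompactSupport
      (hc.fderiv_apply ℝ v)
  -- Integration by parts with the constant function `1` as the other factor.
  have h := integral_mul_fderiv_eq_neg_fderiv_mul_of_integrable (μ := ν) (f := fun _ : E => (1 : ℂ))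
    (g := Φ) (v := v) (by simp) (by simpa using hi)
    (by simpa using hΦ.continuous.integrable_of_hasCompactSupport hc)
    (fun _ _ => differentiableAt_const _) (fun x _ => hΦ.differentiable (by simp) x)
  simpa using h

lemma integral_holDeriv_eq_zero (hΦ : ContDiff ℝ 1 Φ) (hc : HasCompactSupport Φ) (v : E) :
    ∫ g, holDeriv Φ g v ∂ν = 0 := by
  have hi (u : E) : Integrable (fun g => fderiv ℝ Φ g u) ν :=
    ((hΦ.continuous_fderiv one_ne_zero).clm_apply continuous_const).integrable_of_hasCompactSupport
      (hc.fderiv_apply ℝ u)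
  simp only [holDeriv]
  rw [integral_const_mul, integral_sub (hi v) ((hi _).const_mul _), integral_const_mul,
    integral_fderiv_eq_zero ν hΦ hc, integral_fderiv_eq_zero ν hΦ hc]
  simp

omit [FiniteDimensional ℝ E] [MeasurableSpace E] [BorelSpace E] in
lemma continuous_holDeriv (hΦ : ContDiff ℝ 1 Φ) {v : E → E} (hv : Continuous v)
    (hv' : Continuous fun g => Complex.I • v g) : Continuous fun g => holDeriv Φ g (v g) :=
  continuous_const.mul (((hΦ.continuous_fderiv one_ne_zero).clm_apply hv).sub
    (continuous_const.mul ((hΦ.continuous_fderiv one_ne_zero).clm_apply hv')))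

omit [FiniteDimensional ℝ E] [MeasurableSpace E] [BorelSpace E] in
lemma hasCompactSupport_holDeriv (hc : HasCompactSupport Φ) (v : E → E) :
    HasCompactSupport fun g => holDeriv Φ g (v g) := by
  refine (hc.fderiv ℝ).mono fun g hg => ?_
  contrapose! hg
  simp [holDeriv, Function.notMem_support.1 hg]

omit [NormedSpace ℝ E] [NormedSpace ℂ E] [FiniteDimensional ℝ E] in
lemma integrable_of_continuous (hΦ : Continuous Φ) (hc : HasCompactSupport Φ) :
    Integrable Φ ν :=
  hΦ.integrable_of_hasCompactSupport hc

omit [NormedSpace ℝ E] [NormedSpace ℂ E] [FiniteDimensional ℝ E] in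
lemma integral_pos_of_continuous {f : E → ℝ} (hf : Continuous f) (hc : HasCompactSupport f)
    (h0 : 0 ≤ f) {x : E} (hx : f x ≠ 0) : 0 < ∫ g, f g ∂ν :=
  hf.integral_pos_of_hasCompactSupport_nonneg_nonzero hc h0 hx

omit [NormedSpace ℂ E] in
variable (E) in
lemma exists_isAddHaarMeasure : ∃ ν : Measure E, ν.IsAddHaarMeasure :=
  ⟨Measure.addHaar, inferInstance⟩

end Integration

/-! ### Test functions of the weight -/

/-- Smooth functions on the real line which vanish near the nonpositive half line. -/
def IsTestFun (h : ℝ → ℝ) : Prop := ContDiff ℝ ∞ h ∧ ∃ δ, 0 < δ ∧ ∀ s < δ, h s = 0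

/-- The operator `h ↦ s h' + p h`. -/
def thetaOp (p : ℕ) (h : ℝ → ℝ) : ℝ → ℝ := fun s => s * deriv h s + p * h s

lemma IsTestFun.thetaOp {h : ℝ → ℝ} (hh : IsTestFun h) (p : ℕ) : IsTestFun (thetaOp p h) := by
  obtain ⟨hs, δ, hδ, h0⟩ := hh
  refine ⟨(contDiff_id.mul ?_).add (contDiff_const.mul hs), δ, hδ, fun s hs => ?_⟩
  · exact (contDiff_infty_iff_deriv.1 hs).2
  · have : h =ᶠ[𝓝 s] fun _ => 0 := by
      filter_upwards [gt_mem_nhds hs] with t ht using h0 t ht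
    rw [GrassmannStar.thetaOp, this.deriv_eq, h0 s hs, deriv_const, mul_zero, mul_zero, add_zero]

/-- The function `h(ψ) exp (- p tr x / μ)` on an orbit, with `ψ` the weight function. -/
def testWeight (μ : ℝ) (z : Matrix (Fin m) (Fin p) ℂ) (h : ℝ → ℝ)
    (g : Matrix (Fin p) (Fin p) ℂ) : ℝ :=
  h (orbitWeight μ z g) * Real.exp (-(p / μ) * orbitTrace z g)

lemma contDiff_testWeight (μ : ℝ) (z : Matrix (Fin m) (Fin p) ℂ) {h : ℝ → ℝ} (hh : IsTestFun h) :
    ContDiff ℝ ∞ fun g => (testWeight μ z h g : ℂ) :=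
  Complex.ofRealCLM.contDiff.comp ((hh.1.comp (contDiff_orbitWeight μ z)).mul
    (Real.contDiff_exp.comp (contDiff_const.mul (contDiff_orbitTrace z))))

/-- The factor `exp(−p tr x/μ)` is there to absorb the divergence `p δ_{ij}` of the field `g ↦ g
e_{ij}`: its derivative supplies `−(p/μ) x_{ji}`, and the two add up to `−(p/μ)(x − μ)_{ji}`. The
whole expression is then again `x − μ` times a test weight, now for `s h' + p h`. -/
lemma holDeriv_testWeight {μ : ℝ} (hμ : 0 < μ) (z : Matrix (Fin m) (Fin p) ℂ) {h : ℝ → ℝ}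
    (hh : IsTestFun h) (g : Matrix (Fin p) (Fin p) ℂ) (i j : Fin p) :
    holDeriv (fun g => (testWeight μ z h g : ℂ)) g (g * Matrix.single i j 1) +
      (p * (1 : Matrix (Fin p) (Fin p) ℂ) j i) * testWeight μ z h g =
    -(1 / μ) * ((orbitMat z g - (μ : ℂ) • (1 : Matrix (Fin p) (Fin p) ℂ)) j i *
      testWeight μ z (thetaOp p h) g) := by
  have hsplit : (fun g => (testWeight μ z h g : ℂ)) =
      (fun g => ((h (orbitWeight μ z g) : ℝ) : ℂ)) *
        fun g => ((Real.exp (-(p / μ) * orbitTrace z g) : ℝ) : ℂ) := by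
    ext g; simp [testWeight]
  have hw := (contDiff_orbitWeight μ z).differentiable (by simp) g
  have hhd := hh.1.differentiable (by simp) (orbitWeight μ z g)
  have h1 : DifferentiableAt ℝ (fun g => ((h (orbitWeight μ z g) : ℝ) : ℂ)) g :=
    Complex.ofRealCLM.differentiableAt.comp g (hhd.comp g hw)
  have h2 : DifferentiableAt ℝ (fun g => ((Real.exp (-(p / μ) * orbitTrace z g) : ℝ) : ℂ)) g :=
    Complex.ofRealCLM.differentiableAt.comp g
      (((contDiff_orbitTrace z).differentiable (by simp) g).const_mul _).exp
  have e1 := (holDeriv_comp_real hhd hw (g * Matrix.single i j 1)).trans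
    (congrArg _ (holDeriv_orbitWeight μ z g (Matrix.single i j 1)))
  have e2 := holDeriv_exp_orbitTrace (p / μ) z g (Matrix.single i j 1)
  have e3 := holDeriv_mul h1 h2 (g * Matrix.single i j 1)
  rw [e1, e2, ← hsplit] at e3
  have htr : (Matrix.single i j (1 : ℂ)).trace = (1 : Matrix (Fin p) (Fin p) ℂ) j i := by
    by_cases hij : i = j
    · subst hij; simp
    · rw [Matrix.trace_single_eq_of_ne _ _ _ hij, Matrix.one_apply_ne (Ne.symm hij)]
  have htr2 : (orbitMat z g * Matrix.single i j (1 : ℂ)).trace = orbitMat z g j i := by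
    rw [Matrix.trace_mul_single]
    simp
  rw [htr, htr2] at e3
  refine (congrArg (· + _) e3).trans ?_
  have hμ' : (μ : ℂ) ≠ 0 := by exact_mod_cast hμ.ne'
  rw [Matrix.sub_apply, Matrix.smul_apply, smul_eq_mul]
  simp only [testWeight, thetaOp]
  push_cast
  field_simp
  ring

variable {μ : ℝ} (z : PhaseSpace p q) {h : ℝ → ℝ} {F : Matrix (Fin p) (Fin p) ℂ → ℂ}

/-- Test weights vanish near the singular matrices, so `F` needs regularity only where `det g ≠ 0`.
-/
lemma eventually_mul_testWeight_eq_zero (hh : IsTestFun h) {g : Matrix (Fin p) (Fin p) ℂ}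
    (hg : ¬ 0 < orbitWeight μ z.1 g) (F : Matrix (Fin p) (Fin p) ℂ → ℂ) :
    (fun g => F g * (testWeight μ z.1 h g : ℂ)) =ᶠ[𝓝 g] fun _ => 0 := by
  obtain ⟨-, δ, hδ, h0⟩ := hh
  have : ∀ᶠ g' in 𝓝 g, orbitWeight μ z.1 g' < δ :=
    (contDiff_orbitWeight μ z.1).continuous.continuousAt.eventually
      (gt_mem_nhds ((not_lt.1 hg).trans_lt hδ))
  filter_upwards [this] with g' hg'
  simp [testWeight, h0 _ hg']

lemma continuous_mul_testWeight (hh : IsTestFun h)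
    (hF : ∀ g, 0 < orbitWeight μ z.1 g → ContinuousAt F g) :
    Continuous fun g => F g * (testWeight μ z.1 h g : ℂ) := by
  rw [continuous_iff_continuousAt]
  intro g
  by_cases hg : 0 < orbitWeight μ z.1 g
  · exact (hF g hg).mul (contDiff_testWeight μ z.1 hh).continuous.continuousAt
  · exact continuousAt_const.congr (eventually_mul_testWeight_eq_zero z hh hg F).symm

lemma contDiff_mul_testWeight (hh : IsTestFun h)
    (hF : ∀ g, 0 < orbitWeight μ z.1 g → ContDiffAt ℝ ∞ F g) :
    ContDiff ℝ 1 fun g => F g * (testWeight μ z.1 h g : ℂ) := by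
  rw [contDiff_iff_contDiffAt]
  intro g
  by_cases hg : 0 < orbitWeight μ z.1 g
  · exact ((hF g hg).mul (contDiff_testWeight μ z.1 hh).contDiffAt).of_le (by simp)
  · exact contDiffAt_const.congr_of_eventuallyEq (eventually_mul_testWeight_eq_zero z hh hg F)

lemma hasCompactSupport_mul_testWeight (hμ : 0 < μ) (hh : IsTestFun h)
    (F : Matrix (Fin p) (Fin p) ℂ → ℂ) :
    HasCompactSupport fun g => F g * (testWeight μ z.1 h g : ℂ) := by
  obtain ⟨-, δ, hδ, h0⟩ := hh
  refine HasCompactSupport.intro (isCompact_superlevel hμ z hδ) fun g hg => ?_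
  simp [testWeight, h0 _ (not_le.1 hg)]

/-- The entries of `x - μ` on an orbit. -/
def orbitMoment (μ : ℝ) (z : Matrix (Fin m) (Fin p) ℂ) (j i : Fin p)
    (g : Matrix (Fin p) (Fin p) ℂ) : ℂ :=
  (orbitMat z g - (μ : ℂ) • (1 : Matrix (Fin p) (Fin p) ℂ)) j i

lemma continuous_orbitMoment (μ : ℝ) (z : Matrix (Fin m) (Fin p) ℂ) (j i : Fin p) :
    Continuous (orbitMoment μ z j i) :=
  (contDiff_orbitMat z j i).continuous.sub continuous_const

/-! ### Integration by parts on an orbit -/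

/-- `BorelSpace` for the topology defined by the norm. -/
abbrev NormBorelSpace (E : Type*) [NormedAddCommGroup E] [MeasurableSpace E] : Prop := BorelSpace E

/-- `IsAddHaarMeasure` for the topology defined by the norm. -/
abbrev NormHaar {E : Type*} [NormedAddCommGroup E] [MeasurableSpace E] (ν : Measure E) : Prop :=
  ν.IsAddHaarMeasure

variable [MeasurableSpace (Matrix (Fin p) (Fin p) ℂ)] [NormBorelSpace (Matrix (Fin p) (Fin p) ℂ)]
  (ν : Measure (Matrix (Fin p) (Fin p) ℂ)) [NormHaar ν]

lemma integrable_of_contDiff_holDeriv {Φ : Matrix (Fin p) (Fin p) ℂ → ℂ} (hΦ : ContDiff ℝ 1 Φ)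
    (hc : HasCompactSupport Φ) (X : Matrix (Fin p) (Fin p) ℂ) :
    Integrable (fun g => holDeriv Φ g (g * X)) ν :=
  (continuous_holDeriv hΦ (v := fun g => g * X) (continuous_id.matrix_mul continuous_const)
    ((continuous_id.matrix_mul continuous_const).const_smul _)).integrable_of_hasCompactSupport
    (hasCompactSupport_holDeriv hc _)

/-- The integrand is the total divergence `∑_k ∂(Φ g_{ki})/∂g_{kj}`, each term of which integrates
to zero; the `p` summands with `g_{ki}` differentiated give `p δ_{ij} Φ`. -/
lemma integral_holDeriv_mul_single {Φ : Matrix (Fin p) (Fin p) ℂ → ℂ} (hΦ : ContDiff ℝ 1 Φ)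
    (hc : HasCompactSupport Φ) (i j : Fin p) :
    ∫ g, (holDeriv Φ g (g * Matrix.single i j 1) +
      (p * (1 : Matrix (Fin p) (Fin p) ℂ) j i) * Φ g) ∂ν = 0 := by
  have hent (k : Fin p) : ContDiff ℝ 1 fun g : Matrix (Fin p) (Fin p) ℂ => g k i :=
    (contDiff_matrix_apply k i).of_le (by simp)
  have hk (k : Fin p) : ContDiff ℝ 1 (Φ * fun g => g k i) := hΦ.mul (hent k)
  have hkc (k : Fin p) : HasCompactSupport (Φ * fun g => g k i) := hc.mul_right
  have h (g : Matrix (Fin p) (Fin p) ℂ) : holDeriv Φ g (g * Matrix.single i j 1) +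
      (p * (1 : Matrix (Fin p) (Fin p) ℂ) j i) * Φ g =
      ∑ k, holDeriv (Φ * fun g => g k i) g (Matrix.single k j 1 : Matrix (Fin p) (Fin p) ℂ) := by
    have hprod (k : Fin p) : holDeriv (Φ * fun g => g k i) g
        (Matrix.single k j 1 : Matrix (Fin p) (Fin p) ℂ) =
        Φ g * (1 : Matrix (Fin p) (Fin p) ℂ) j i +
          g k i * holDeriv Φ g (Matrix.single k j 1 : Matrix (Fin p) (Fin p) ℂ) := by
      refine (holDeriv_mul (hΦ.differentiable (by simp) g)
        ((hent k).differentiable (by simp) g) _).trans ?_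
      refine congrArg₂ _ (congrArg _ ((holDeriv_entry k i g _).trans ?_)) (mul_comm _ _)
      simp [Matrix.single_apply, Matrix.one_apply]
    simp only [hprod, Finset.sum_add_distrib]
    rw [Finset.sum_const, Finset.card_univ, Fintype.card_fin, nsmul_eq_mul, add_comm]
    refine congrArg₂ _ (by ring) (holDeriv_mul_single Φ g i j)
  simp only [h]
  rw [integral_finsetSum]
  · exact Finset.sum_eq_zero fun k _ => integral_holDeriv_eq_zero ν (hk k) (hkc k) _
  · intro k _
    exact (continuous_holDeriv (hk k) continuous_const
      continuous_const).integrable_of_hasCompactSupport (hasCompactSupport_holDeriv (hkc k) _)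

lemma integrable_mul_testWeight (hμ : 0 < μ) (hh : IsTestFun h)
    (hF : ∀ g, 0 < orbitWeight μ z.1 g → ContinuousAt F g) :
    Integrable (fun g => F g * (testWeight μ z.1 h g : ℂ)) ν :=
  integrable_of_continuous ν (continuous_mul_testWeight z hh hF)
    (hasCompactSupport_mul_testWeight z hμ hh F)

/-- Moves the generator from `F` to the test weight. The result contains the factor `x − μ` and
another test weight, so it is an integral of the kind controlled by the previous order in `λ`. -/
lemma integrable_and_integral_holDeriv_mul_testWeight (hμ : 0 < μ) (hh : IsTestFun h)
    (hF : ∀ g, 0 < orbitWeight μ z.1 g → ContDiffAt ℝ ∞ F g) (i j : Fin p) :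
    Integrable (fun g => holDeriv F g (g * Matrix.single i j 1) * (testWeight μ z.1 h g : ℂ)) ν ∧
    ∫ g, holDeriv F g (g * Matrix.single i j 1) * (testWeight μ z.1 h g : ℂ) ∂ν =
      (1 / μ) * ∫ g, (F g * orbitMoment μ z.1 j i g) *
        (testWeight μ z.1 (thetaOp p h) g : ℂ) ∂ν := by
  set Φ := fun g => F g * (testWeight μ z.1 h g : ℂ) with hΦ
  have hΦd : ContDiff ℝ 1 Φ := contDiff_mul_testWeight z hh hF
  have hΦc : HasCompactSupport Φ := hasCompactSupport_mul_testWeight z hμ hh F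
  have hpt (g : Matrix (Fin p) (Fin p) ℂ) :
      holDeriv F g (g * Matrix.single i j 1) * (testWeight μ z.1 h g : ℂ) =
      (holDeriv Φ g (g * Matrix.single i j 1) +
        (p * (1 : Matrix (Fin p) (Fin p) ℂ) j i) * Φ g) +
      (1 / μ) * ((F g * orbitMoment μ z.1 j i g) *
        (testWeight μ z.1 (thetaOp p h) g : ℂ)) := by
    by_cases hg : 0 < orbitWeight μ z.1 g
    · have h1 := holDeriv_mul ((hF g hg).differentiableAt (by simp))
        ((contDiff_testWeight μ z.1 hh).differentiable (by simp) g) (g * Matrix.single i j 1)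
      have h2 := holDeriv_testWeight hμ z.1 hh g i j
      have h3 : holDeriv Φ g (g * Matrix.single i j 1) = _ := h1
      rw [h3, hΦ, orbitMoment]
      linear_combination -F g * h2
    · have h1 := eventually_mul_testWeight_eq_zero z hh hg F
      have h2 : holDeriv Φ g (g * Matrix.single i j 1) = 0 :=
        (holDeriv_congr h1 _).trans (holDeriv_const 0 _)
      have h3 : holDeriv F g (g * Matrix.single i j 1) * (testWeight μ z.1 h g : ℂ) = 0 :=
        (eventually_mul_testWeight_eq_zero z hh hg
        fun g => holDeriv F g (g * Matrix.single i j 1)).eq_of_nhds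
      have h4 : F g * orbitMoment μ z.1 j i g * (testWeight μ z.1 (thetaOp p h) g : ℂ) = 0 :=
        (eventually_mul_testWeight_eq_zero z (hh.thetaOp p) hg
        fun g => F g * orbitMoment μ z.1 j i g).eq_of_nhds
      have h5 : Φ g = 0 := h1.eq_of_nhds
      rw [h2, h3, h4, h5]
      ring
  have hi1 : Integrable (fun g => holDeriv Φ g (g * Matrix.single i j 1) +
      (p * (1 : Matrix (Fin p) (Fin p) ℂ) j i) * Φ g) ν :=
    (integrable_of_contDiff_holDeriv ν hΦd hΦc _).add
      ((hΦd.continuous.integrable_of_hasCompactSupport hΦc).const_mul _)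
  have hi2 : Integrable (fun g => (F g * orbitMoment μ z.1 j i g) *
      (testWeight μ z.1 (thetaOp p h) g : ℂ)) ν :=
    integrable_mul_testWeight z ν hμ (hh.thetaOp p) fun g hg =>
      (hF g hg).continuousAt.mul (continuous_orbitMoment μ z.1 j i).continuousAt
  simp only [hpt]
  refine ⟨hi1.add (hi2.const_mul _), ?_⟩
  rw [integral_add hi1 (hi2.const_mul _), integral_holDeriv_mul_single ν hΦd hΦc, zero_add,
    integral_const_mul]

end GrassmannStar

end

/-! ### Concentration at the maximum and uniqueness of the decomposition -/

noncomputable section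

namespace GrassmannStar

open Matrix Topology Filter MeasureTheory
open scoped ComplexOrder

variable {p q : ℕ}

/-! ### Concentration near the maximum of the weight function -/

/-- On the compact set where the weight is at least half its maximum and `‖k‖ ≥ ε`, the weight
attains its largest value. That value lies strictly below the maximum, since `x = μ` and hence `k =
0` at every maximizer, and it serves as `δ`. -/
lemma exists_lt_norm_lt {μ : ℝ} (hμ : 0 < μ) (z : PhaseSpace p q)
    {k : Matrix (Fin p) (Fin p) ℂ → ℂ} {ε : ℝ} (hε : 0 < ε)
    (hk : ∀ g, 0 < orbitWeight μ z.1 g → ContinuousAt k g)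
    (hk0 : ∀ g, (∀ j i, orbitMoment μ z.1 j i g = 0) → k g = 0)
    {g₀ : Matrix (Fin p) (Fin p) ℂ} (hpos : 0 < orbitWeight μ z.1 g₀)
    (hmax : ∀ g, orbitWeight μ z.1 g ≤ orbitWeight μ z.1 g₀) :
    ∃ δ, 0 < δ ∧ δ < orbitWeight μ z.1 g₀ ∧ ∀ g, δ < orbitWeight μ z.1 g → ‖k g‖ < ε := by
  set M := orbitWeight μ z.1 g₀ with hM
  have hcont : Continuous (orbitWeight μ z.1) := (contDiff_orbitWeight μ z.1).continuous
  have hK : IsClosed {g | M / 2 ≤ orbitWeight μ z.1 g} := isClosed_le continuous_const hcont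
  have hkc : ContinuousOn (fun g => ‖k g‖) {g | M / 2 ≤ orbitWeight μ z.1 g} := fun g hg =>
    ((hk g ((half_pos hpos).trans_le hg)).norm).continuousWithinAt
  have hL := (isCompact_superlevel hμ z (half_pos hpos)).of_isClosed_subset
    (hkc.preimage_isClosed_of_isClosed hK (isClosed_Ici (a := ε))) Set.inter_subset_left
  rcases Set.eq_empty_or_nonempty
    ({g | M / 2 ≤ orbitWeight μ z.1 g} ∩ (fun g => ‖k g‖) ⁻¹' Set.Ici ε) with hemp | hne
  · refine ⟨M / 2, half_pos hpos, half_lt_self hpos, fun g hg => ?_⟩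
    by_contra hlt
    exact (Set.eq_empty_iff_forall_notMem.1 hemp) g ⟨hg.le, not_lt.1 hlt⟩
  · obtain ⟨g₁, hg₁, hmax₁⟩ := hL.exists_isMaxOn hne hcont.continuousOn
    have hlt : orbitWeight μ z.1 g₁ < M := by
      refine lt_of_le_of_ne (hmax g₁) fun heq => ?_
      have h0 := hk0 g₁ fun j i => orbitMat_eq_of_max hμ z.1 (by rw [heq]; exact hpos)
        (fun g => by rw [heq]; exact hmax g) j i
      have h1 : ε ≤ ‖k g₁‖ := hg₁.2
      rw [h0, norm_zero] at h1
      exact absurd hε (not_lt.2 h1)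
    refine ⟨orbitWeight μ z.1 g₁, (half_pos hpos).trans_le hg₁.1, hlt, fun g hg => ?_⟩
    by_contra hge
    exact absurd hg (not_lt.2 (hmax₁ ⟨hg₁.1.trans hg.le, not_lt.1 hge⟩))

lemma isTestFun_expNegInvGlue {δ : ℝ} (hδ : 0 < δ) :
    IsTestFun fun s => expNegInvGlue (s - δ) :=
  ⟨expNegInvGlue.contDiff.comp (contDiff_id.sub contDiff_const), δ, hδ, fun s hs =>
    expNegInvGlue.zero_of_nonpos (by linarith)⟩

lemma testWeight_eq_zero {μ : ℝ} (z : PhaseSpace p q) {h : ℝ → ℝ} (hh : IsTestFun h)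
    {g : Matrix (Fin p) (Fin p) ℂ} (hg : ¬ 0 < orbitWeight μ z.1 g) : testWeight μ z.1 h g = 0 := by
  obtain ⟨-, δ, hδ, h0⟩ := hh
  rw [testWeight, h0 _ ((not_lt.1 hg).trans_lt hδ), zero_mul]

section Measure

variable [MeasurableSpace (Matrix (Fin p) (Fin p) ℂ)] [NormBorelSpace (Matrix (Fin p) (Fin p) ℂ)]
  (ν : Measure (Matrix (Fin p) (Fin p) ℂ)) [NormHaar ν]

/-- If `a ≠ 0`, choose a superlevel set of the weight on which `‖k‖ < ‖a‖` and a nonnegative test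
function supported there. Then `a − k`, rotated by the conjugate of `a`, has positive real part on
that set, so its integral cannot vanish. -/
lemma eq_zero_of_forall_integral_testWeight {μ : ℝ} (hμ : 0 < μ) (z : PhaseSpace p q)
    {k : Matrix (Fin p) (Fin p) ℂ → ℂ} {a : ℂ}
    (hk : ∀ g, 0 < orbitWeight μ z.1 g → ContinuousAt k g)
    (hk0 : ∀ g, (∀ j i, orbitMoment μ z.1 j i g = 0) → k g = 0)
    (hint : ∀ h, IsTestFun h → ∫ g, (a - k g) * (testWeight μ z.1 h g : ℂ) ∂ν = 0) : a = 0 := by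
  by_contra ha
  obtain ⟨g₀, hpos, hmax⟩ := exists_max_orbitWeight hμ z
  obtain ⟨δ, hδ, hδM, hlt⟩ := exists_lt_norm_lt hμ z (norm_pos_iff.2 ha) hk hk0 hpos hmax
  have hh := isTestFun_expNegInvGlue hδ
  set h : ℝ → ℝ := fun s => expNegInvGlue (s - δ)
  -- The real part of this product is at least `‖a‖² − ‖a‖ ‖k g‖`.
  set F : Matrix (Fin p) (Fin p) ℂ → ℂ := fun g => (starRingEnd ℂ) a * (a - k g)
  have hFc : ∀ g, 0 < orbitWeight μ z.1 g → ContinuousAt F g := fun g hg =>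
    continuousAt_const.mul (continuousAt_const.sub (hk g hg))
  have hcont := continuous_mul_testWeight z hh hFc
  have hsupp := hasCompactSupport_mul_testWeight z hμ hh F
  have hFpos : ∀ g, δ < orbitWeight μ z.1 g → 0 < (F g).re := fun g hg => by
    have h1 : (F g).re = ‖a‖ ^ 2 - ((starRingEnd ℂ) a * k g).re := by
      simp only [F, mul_sub, Complex.sub_re]
      rw [← Complex.normSq_eq_conj_mul_self, Complex.ofReal_re, Complex.normSq_eq_norm_sq]
    have h2 : ((starRingEnd ℂ) a * k g).re ≤ ‖a‖ * ‖k g‖ := by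
      refine (Complex.re_le_norm _).trans ?_
      rw [norm_mul, RCLike.norm_conj]
    have h3 : ‖a‖ * ‖k g‖ < ‖a‖ ^ 2 := by
      rw [pow_two]
      exact mul_lt_mul_of_pos_left (hlt g hg) (norm_pos_iff.2 ha)
    linarith
  have hre (g : Matrix (Fin p) (Fin p) ℂ) : (F g * (testWeight μ z.1 h g : ℂ)).re =
      (F g).re * testWeight μ z.1 h g := Complex.re_mul_ofReal _ _
  have hnonneg : ∀ g, 0 ≤ (F g * (testWeight μ z.1 h g : ℂ)).re := fun g => by
    rw [hre]
    by_cases hg : δ < orbitWeight μ z.1 g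
    · exact mul_nonneg (hFpos g hg).le
        (mul_nonneg (expNegInvGlue.nonneg _) (Real.exp_pos _).le)
    · have h0 : h (orbitWeight μ z.1 g) = 0 :=
        expNegInvGlue.zero_of_nonpos (sub_nonpos.2 (not_lt.1 hg))
      rw [testWeight, h0, zero_mul, mul_zero]
  have hne : (F g₀ * (testWeight μ z.1 h g₀ : ℂ)).re ≠ 0 := by
    rw [hre]
    exact (mul_pos (hFpos g₀ hδM)
      (mul_pos (expNegInvGlue.pos_of_pos (sub_pos.2 hδM)) (Real.exp_pos _))).ne'
  have hlt0 := integral_pos_of_continuous ν (Complex.continuous_re.comp hcont)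
    (hsupp.comp_left (g := Complex.re) Complex.zero_re) hnonneg hne
  have hint0 : ∫ g, F g * (testWeight μ z.1 h g : ℂ) ∂ν = 0 := by
    simp only [F, mul_assoc]
    rw [integral_const_mul, hint h hh, mul_zero]
  have hcomm := Complex.reCLM.integral_comp_comm (integrable_mul_testWeight z ν hμ hh hFc)
  rw [hint0, map_zero] at hcomm
  exact hlt0.ne' hcomm

/-- One step of the induction on the order in `λ`: if `D` integrates to zero against all test
weights, so does `a − k`. Concentration gives `a = 0`, and then `k = −D` passes the vanishing on to
the next order. -/
lemma eq_zero_and_integral_eq_zero {μ : ℝ} (hμ : 0 < μ) (z : PhaseSpace p q)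
    {k D : Matrix (Fin p) (Fin p) ℂ → ℂ} {a : ℂ}
    (hk : ∀ g, 0 < orbitWeight μ z.1 g → ContinuousAt k g)
    (hk0 : ∀ g, (∀ j i, orbitMoment μ z.1 j i g = 0) → k g = 0)
    (hrel : ∀ g, 0 < orbitWeight μ z.1 g → a = k g + D g)
    (hD : ∀ h, IsTestFun h → ∫ g, D g * (testWeight μ z.1 h g : ℂ) ∂ν = 0) :
    a = 0 ∧ ∀ h, IsTestFun h → ∫ g, k g * (testWeight μ z.1 h g : ℂ) ∂ν = 0 := by
  have hpt {h : ℝ → ℝ} (hh : IsTestFun h) (g : Matrix (Fin p) (Fin p) ℂ) :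
      (a - k g) * (testWeight μ z.1 h g : ℂ) = D g * (testWeight μ z.1 h g : ℂ) := by
    by_cases hg : 0 < orbitWeight μ z.1 g
    · rw [hrel g hg]; ring
    · rw [testWeight_eq_zero z hh hg]; simp
  have ha : a = 0 := eq_zero_of_forall_integral_testWeight ν hμ z hk hk0 fun h hh => by
    simp only [hpt hh]
    exact hD h hh
  refine ⟨ha, fun h hh => ?_⟩
  have : ∀ g, k g * (testWeight μ z.1 h g : ℂ) = -(D g * (testWeight μ z.1 h g : ℂ)) := fun g => by
    rw [← hpt hh g, ha]; ring
  simp only [this]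
  rw [integral_neg, hD h hh, neg_zero]

end Measure

/-! ### Uniqueness of the decomposition -/

/-- The pull back of a function on the phase space to an orbit. -/
def orbitPullback (z : PhaseSpace p q) (f : PhaseSpace p q → ℂ) (g : Matrix (Fin p) (Fin p) ℂ) : ℂ :=
  extend f (leftMulCLM z.1 g)

/-- The point `z g`. -/
def orbitPoint {μ : ℝ} (z : PhaseSpace p q) {g : Matrix (Fin p) (Fin p) ℂ}
    (hg : 0 < orbitWeight μ z.1 g) : PhaseSpace p q :=
  z.act (Matrix.GeneralLinearGroup.mkOfDetNeZero g ((orbitWeight_pos_iff μ z.1 g).1 hg))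

section Orbit

variable {μ : ℝ} (z : PhaseSpace p q) {g : Matrix (Fin p) (Fin p) ℂ}
  (hg : 0 < orbitWeight μ z.1 g)

include hg

lemma orbitPullback_eq (f : PhaseSpace p q → ℂ) :
    orbitPullback z f g = f (orbitPoint z hg) :=
  extend_apply f (orbitPoint z hg)

lemma contDiffAt_orbitPullback {f : PhaseSpace p q → ℂ} (hf : IsSmooth f) :
    ContDiffAt ℝ ∞ (orbitPullback z f) g :=
  ContDiffAt.comp g (hf.contDiffAt (orbitPoint z hg))
    ((leftMulCLM z.1).restrictScalars ℝ).contDiff.contDiffAt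

lemma holDeriv_orbitPullback {f : PhaseSpace p q → ℂ} (hf : IsSmooth f) (i j : Fin p) :
    holDeriv (orbitPullback z f) g (g * Matrix.single i j 1) = euler i j f (orbitPoint z hg) := by
  refine (holDeriv_comp_clm (leftMulCLM z.1) (hf.differentiableAt (orbitPoint z hg)) _).trans ?_
  rw [euler_eq_holDeriv]
  exact congrArg (holDeriv (extend f) (z.1 * g))
    (Matrix.mul_assoc z.1 g (Matrix.single i j 1)).symm

lemma momentEntry_orbitPoint (j i : Fin p) :
    momentEntry μ j i (orbitPoint z hg) = orbitMoment μ z.1 j i g := rfl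

end Orbit

lemma orbitMoment_sum_eq_coeff {μ : ℝ} (z : PhaseSpace p q) {g : Matrix (Fin p) (Fin p) ℂ}
    (hg : 0 < orbitWeight μ z.1 g) (G : Matrix (Fin p) (Fin p) (FormalFun p q)) (n : ℕ) :
    (∑ i, ∑ j, orbitPullback z (PowerSeries.coeff n (G i j)) g * orbitMoment μ z.1 j i g) =
      PowerSeries.coeff n (∑ i, ∑ j, G i j * PowerSeries.C (momentEntry μ j i) : FormalFun p q)
        (orbitPoint z hg) := by
  simp only [map_sum, Finset.sum_apply, PowerSeries.coeff_mul_C, Pi.mul_apply]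
  exact Finset.sum_congr rfl fun i _ => Finset.sum_congr rfl fun j _ => by
    rw [orbitPullback_eq z hg, momentEntry_orbitPoint z hg]

lemma holDeriv_sum_eq_coeff {μ : ℝ} (z : PhaseSpace p q) {g : Matrix (Fin p) (Fin p) ℂ}
    (hg : 0 < orbitWeight μ z.1 g) {G : Matrix (Fin p) (Fin p) (FormalFun p q)} {n : ℕ}
    (hG : ∀ i j, IsSmooth (PowerSeries.coeff n (G i j))) :
    (∑ i, ∑ j, holDeriv (orbitPullback z (PowerSeries.coeff n (G i j))) g
        (g * Matrix.single i j 1)) =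
      PowerSeries.coeff (n + 1) (∑ i, ∑ j, PowerSeries.X * eulerFormal i j (G i j) : FormalFun p q)
        (orbitPoint z hg) := by
  simp only [map_sum, Finset.sum_apply, PowerSeries.coeff_succ_X_mul]
  exact Finset.sum_congr rfl fun i _ => Finset.sum_congr rfl fun j _ => by
    rw [holDeriv_orbitPullback z hg (hG i j), eulerFormal, PowerSeries.coeff_mk]

lemma integral_holDeriv_sum {μ : ℝ} (hμ : 0 < μ) (z : PhaseSpace p q)
    [MeasurableSpace (Matrix (Fin p) (Fin p) ℂ)] [NormBorelSpace (Matrix (Fin p) (Fin p) ℂ)]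
    (ν : Measure (Matrix (Fin p) (Fin p) ℂ)) [NormHaar ν] {h : ℝ → ℝ} (hh : IsTestFun h)
    {F : Fin p → Fin p → Matrix (Fin p) (Fin p) ℂ → ℂ}
    (hF : ∀ i j g, 0 < orbitWeight μ z.1 g → ContDiffAt ℝ ∞ (F i j) g) :
    ∫ g, (∑ i, ∑ j, holDeriv (F i j) g (g * Matrix.single i j 1)) * (testWeight μ z.1 h g : ℂ) ∂ν =
      ((1 / μ : ℝ) : ℂ) * ∫ g, (∑ i, ∑ j, F i j g * orbitMoment μ z.1 j i g) *
        (testWeight μ z.1 (thetaOp p h) g : ℂ) ∂ν := by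
  have key i j := integrable_and_integral_holDeriv_mul_testWeight z ν hμ hh (hF i j) i j
  have hi i j : Integrable (fun g => (F i j g * orbitMoment μ z.1 j i g) *
      (testWeight μ z.1 (thetaOp p h) g : ℂ)) ν :=
    integrable_mul_testWeight z ν hμ (hh.thetaOp p) fun g hg =>
      (hF i j g hg).continuousAt.mul (continuous_orbitMoment μ z.1 j i).continuousAt
  simp only [Finset.sum_mul]
  rw [integral_finsetSum _ fun i _ => integrable_finsetSum _ fun j _ => (key i j).1,
    integral_finsetSum _ fun i _ => integrable_finsetSum _ fun j _ => hi i j, Finset.mul_sum]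
  refine Finset.sum_congr rfl fun i _ => ?_
  rw [integral_finsetSum _ fun j _ => (key i j).1, integral_finsetSum _ fun j _ => hi i j,
    Finset.mul_sum]
  refine Finset.sum_congr rfl fun j _ => ?_
  rw [(key i j).2]
  simp

theorem eq_zero_of_isHomogeneous_of_inStarIdeal {μ : ℝ} (hμ : 0 < μ) (f : FormalFun p q)
    (hf : IsHomogeneous f) (hJ : InStarIdeal μ f) : f = 0 := by
  obtain ⟨G, hG, hfG⟩ := (inStarIdeal_iff μ f).1 hJ
  simp only [Finset.sum_add_distrib] at hfG
  let _ : MeasurableSpace (Matrix (Fin p) (Fin p) ℂ) := borel _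
  have : NormBorelSpace (Matrix (Fin p) (Fin p) ℂ) := ⟨rfl⟩
  obtain ⟨ν, hν⟩ := exists_isAddHaarMeasure (Matrix (Fin p) (Fin p) ℂ)
  have : NormHaar ν := hν
  ext n z
  have hF (n : ℕ) (i j : Fin p) (g : Matrix (Fin p) (Fin p) ℂ) (hg : 0 < orbitWeight μ z.1 g) :
      ContDiffAt ℝ ∞ (orbitPullback z (PowerSeries.coeff n (G i j))) g :=
    contDiffAt_orbitPullback z hg ((hG n).1 i j)
  have hrel (n : ℕ) {g : Matrix (Fin p) (Fin p) ℂ} (hg : 0 < orbitWeight μ z.1 g) :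
      PowerSeries.coeff n f z =
        (∑ i, ∑ j, orbitPullback z (PowerSeries.coeff n (G i j)) g * orbitMoment μ z.1 j i g) +
        PowerSeries.coeff n (∑ i, ∑ j, PowerSeries.X * eulerFormal i j (G i j) : FormalFun p q)
          (orbitPoint z hg) := by
    rw [orbitMoment_sum_eq_coeff z hg, ← Pi.add_apply, ← map_add, ← hfG]
    exact ((hf n).2 z _).symm
  have hk (n : ℕ) (g : Matrix (Fin p) (Fin p) ℂ) (hg : 0 < orbitWeight μ z.1 g) :
      ContinuousAt (fun g => ∑ i, ∑ j,
        orbitPullback z (PowerSeries.coeff n (G i j)) g * orbitMoment μ z.1 j i g) g :=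
    tendsto_finsetSum _ fun i _ => tendsto_finsetSum _ fun j _ =>
      (hF n i j g hg).continuousAt.mul (continuous_orbitMoment μ z.1 j i).continuousAt
  have hk0 (n : ℕ) (g : Matrix (Fin p) (Fin p) ℂ) (h0 : ∀ j i, orbitMoment μ z.1 j i g = 0) :
      (∑ i, ∑ j, orbitPullback z (PowerSeries.coeff n (G i j)) g * orbitMoment μ z.1 j i g) = 0 :=
    Finset.sum_eq_zero fun i _ => Finset.sum_eq_zero fun j _ => by rw [h0, mul_zero]
  -- The induction has to carry the vanishing integrals as well: the derivative term at order `n +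
  -- 1` is integrated by parts into such an integral at order `n`.
  suffices h : PowerSeries.coeff n f z = 0 ∧ ∀ h, IsTestFun h → ∫ g, (∑ i, ∑ j,
      orbitPullback z (PowerSeries.coeff n (G i j)) g * orbitMoment μ z.1 j i g) *
        (testWeight μ z.1 h g : ℂ) ∂ν = 0 from h.1
  induction n with
  | zero =>
    -- At order zero the derivative term is absent because it carries a factor `λ`.
    refine eq_zero_and_integral_eq_zero ν hμ z (hk 0) (hk0 0) (D := fun _ => 0)
      (fun g hg => ?_) fun h _ => by simp
    rw [hrel 0 hg]
    simp [PowerSeries.coeff_zero_X_mul]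
  | succ n ih =>
    refine eq_zero_and_integral_eq_zero ν hμ z (hk _) (hk0 _)
      (D := fun g => ∑ i, ∑ j, holDeriv (orbitPullback z (PowerSeries.coeff n (G i j))) g
        (g * Matrix.single i j 1)) (fun g hg => ?_) fun h hh => ?_
    · rw [hrel _ hg, holDeriv_sum_eq_coeff z hg (hG n).1]
    -- The hypothesis is used for the modified test function `s h' + p h`, which is why it
    -- quantifies over all of them.
    · rw [integral_holDeriv_sum hμ z ν hh (hF n), ih.2 _ (hh.thetaOp p), mul_zero]

end GrassmannStar

end

theorem mainTheorem4 (p q r : ℕ) (μ : ℝ) (hμ : 0 < μ) :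
    (∀ B A : Fin r → Fin (p + q), ∃! f : FormalFun p q, IsHomPart μ (STensor p q r B A) f) ∧
    ∀ z : PhaseSpace p q,
      lam ^ r •
        (rho (p + q) (∑ α : ConjClasses (Equiv.Perm (Fin r)),
            cParam μ p ^ numCycles α • classSum (LaurentSeries ℂ) α) *
          laurentAt ((STensor p q r).map (proj μ)) z) =
      (tensorPow (TMat μ z.1) r).map HahnSeries.C := by
  have huniq := eq_zero_of_isHomogeneous_of_inStarIdeal (p := p) (q := q) hμ
  refine ⟨fun B A => ⟨homPartSTensor μ p q r B A, isHomPart_homPartSTensor hμ r B A, fun f hf =>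
    hf.eq_of_forall huniq (isHomPart_homPartSTensor hμ r B A)⟩, fun z => ?_⟩
  have hproj : (STensor p q r).map (proj μ) = homPartSTensor μ p q r := by
    ext1 B A
    exact proj_eq huniq (isHomPart_homPartSTensor hμ r B A)
  rw [hproj]
  exact smul_rho_mul_laurentAt hμ r z
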